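/- Let $\Bbbk$ be a field and let $H$ be a Hopf algebra over $\Bbbk$ with bijective antipode $S$; write $\Delta(h)=\sum h_{(1)}\otimes h_{(2)}$. Algebras are associative $\Bbbk$-algebras, not necessarily unital. A *partial representation* of $H$ in a unital algebra $B$ is a linear map $\pi:H\to B$ with $\pi(1_H)=1_B$, $\sum\pi(h)\pi(k_{(1)})\pi(S(k_{(2)}))=\sum\pi(hk_{(1)})\pi(S(k_{(2)}))$ and $\sum\pi(h_{(1)})\pi(S(h_{(2)}))\pi(k)=\sum\pi(h_{(1)})\pi(S(h_{(2)})k)$ for all $h,k\in H$. A *partial $H$-module* is a vector space $M$ with a partial representation $\pi:H\to\mathrm{End}_\Bbbk(M)$, written $h\bullet m=\pi(h)(m)$; morphisms are the linear maps commuting with $\bullet$, and the resulting category is ${}_H\mathcal M^{par}$. Let $h\mapsto[h]$ be the universal partial representation of $H$, with values in $H_{par}$, and let $A\subseteq H_{par}$ be the subalgebra generated by the elements $\varepsilon_h=\sum[h_{(1)}][S(h_{(2)})]$. Every partial $H$-module $M$ is an $H_{par}$-module via $[h]m=h\bullet m$, and it is an $A$-bimodule with $\varepsilon_h m=\sum h_{(1)}\bullet(S(h_{(2)})\bullet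 m)$ and $m\varepsilon_h=\sum h_{(2)}\bullet(S^{-1}(h_{(1)})\bullet m)$. The tensor product of ${}_H\mathcal M^{par}$ is $M\otimes_A N$ with $h\bullet(m\otimes_A n)=\sum h_{(1)}\bullet m\otimes_A h_{(2)}\bullet n$. A (possibly nonunital) *algebra in ${}_H\mathcal M^{par}$* is a partial $H$-module $V$ with a morphism $\mu:V\otimes_A V\to V$ of partial $H$-modules that is associative, i.e. $\mu(\mu\otimes_A\mathrm{id})=\mu(\mathrm{id}\otimes_A\mu)\alpha$ with $\alpha$ the canonical isomorphism $(V\otimes_AV)\otimes_AV\cong V\otimes_A(V\otimes_AV)$; its underlying algebra is $V$ with the product $xy=\mu(x\otimes_A y)$. A *partial $H$-module algebra with symmetrical partial action* is an algebra $V$ with a linear map $H\otimes V\to V$, $h\otimes a\mapsto h\cdot a$, such that for all $a,b\in V$, $h,k\in H$: $1_H\cdot a=a$; $h\cdot(a(k\cdot b))=\sum(h_{(1)}\cdot a)(h_{(2)}k\cdot b)$; and $h\cdot((k\cdot b)a)=\sum(h_{(1)}k\cdot b)(h_{(2)}\cdot a)$. **Theorem.** Consider only algebras $V$ that are idempotent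 ($V^2=V$), or have trivial left annihilator $\{b: ba=0\ \forall a\in V\}=0$, or have trivial right annihilator $\{a: ba=0\ \forall b\in V\}=0$. On every $\Bbbk$-vector space $V$, the structures of an algebra in ${}_H\mathcal M^{par}$ whose underlying algebra has one of these properties are in bijective correspondence with the structures of a partial $H$-module algebra with symmetrical partial action whose underlying algebra has one of these properties. The correspondence keeps the product, $xy=\mu(x\otimes_A y)$, and the action, $h\cdot x=h\bullet x$. -/

import Mathlib

open scoped TensorProduct
open Coalgebra HopfAlgebra

namespace PartialHopf

section Sweedler

variable {𝕜 H W : Type*} [Field 𝕜] [Ring H] [HopfAlgebra 𝕜 H] [AddCommGroup W] [Module 𝕜 W]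

variable (𝕜) in
/-- The Sweedler sum `∑ f(h₁, h₂)`, where `Δ(h) = ∑ h₁ ⊗ h₂`. It is used for bilinear `f` only,
where it does not depend on the chosen representation of `Δ(h)` as a sum of pure tensors. -/
noncomputable def sweedler (h : H) (f : H → H → W) : W :=
  ∑ i ∈ (ℛ 𝕜 h).index, f ((ℛ 𝕜 h).left i) ((ℛ 𝕜 h).right i)

theorem sweedler_eq_lift (F : H →ₗ[𝕜] H →ₗ[𝕜] W) (h : H) :
    sweedler 𝕜 h (fun a b => F a b) = TensorProduct.lift F (comul h) := by
  rw [← (ℛ 𝕜 h).eq]; simp [sweedler]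

/-- A function that is linear in each of its two arguments, as a bundled bilinear map. -/
noncomputable def bil (f : H → H → W) (h1 : ∀ b, IsLinearMap 𝕜 (fun a => f a b))
    (h2 : ∀ a, IsLinearMap 𝕜 (fun b => f a b)) : H →ₗ[𝕜] H →ₗ[𝕜] W :=
  LinearMap.mk₂ 𝕜 f (fun a a' b => (h1 b).map_add a a') (fun c a b => (h1 b).map_smul c a)
    (fun a b b' => (h2 a).map_add b b') (fun c a b => (h2 a).map_smul c b)

theorem sweedler_eq_bil (f : H → H → W) (h1 : ∀ b, IsLinearMap 𝕜 (fun a => f a b))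
    (h2 : ∀ a, IsLinearMap 𝕜 (fun b => f a b)) (h : H) :
    sweedler 𝕜 h f = TensorProduct.lift (bil f h1 h2) (comul h) := by
  rw [← sweedler_eq_lift]; rfl

section Lin

variable {X M N : Type*} [AddCommGroup X] [Module 𝕜 X] [AddCommGroup M] [Module 𝕜 M]
  [AddCommGroup N] [Module 𝕜 N] {B : Type*} [Ring B] [Algebra 𝕜 B]

theorem lin_id : IsLinearMap 𝕜 (fun x : X => x) := ⟨fun _ _ => rfl, fun _ _ => rfl⟩

theorem lin_comp {f : M → N} {g : X → M} (hf : IsLinearMap 𝕜 f) (hg : IsLinearMap 𝕜 g) :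
    IsLinearMap 𝕜 (fun x => f (g x)) :=
  ⟨fun x y => by rw [hg.map_add, hf.map_add], fun c x => by rw [hg.map_smul, hf.map_smul]⟩

theorem lin_map (F : M →ₗ[𝕜] N) {f : X → M} (hf : IsLinearMap 𝕜 f) :
    IsLinearMap 𝕜 (fun x => F (f x)) :=
  ⟨fun x y => by rw [hf.map_add, map_add], fun c x => by rw [hf.map_smul, map_smul]⟩

theorem lin_app {f : X → M →ₗ[𝕜] N} (hf : IsLinearMap 𝕜 f) (m : M) :
    IsLinearMap 𝕜 (fun x => f x m) :=
  ⟨fun x y => by rw [hf.map_add, LinearMap.add_apply],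
    fun c x => by rw [hf.map_smul, LinearMap.smul_apply]⟩

theorem lin_mul_left {f : X → B} (hf : IsLinearMap 𝕜 f) (b : B) :
    IsLinearMap 𝕜 (fun x => f x * b) :=
  ⟨fun x y => by rw [hf.map_add, add_mul], fun c x => by rw [hf.map_smul, smul_mul_assoc]⟩

theorem lin_mul_right {f : X → B} (b : B) (hf : IsLinearMap 𝕜 f) :
    IsLinearMap 𝕜 (fun x => b * f x) :=
  ⟨fun x y => by rw [hf.map_add, mul_add], fun c x => by rw [hf.map_smul, mul_smul_comm]⟩

theorem lin_tmul_left {f : X → M} (hf : IsLinearMap 𝕜 f) (n : N) :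
    IsLinearMap 𝕜 (fun x => f x ⊗ₜ[𝕜] n) :=
  ⟨fun x y => by rw [hf.map_add, TensorProduct.add_tmul],
    fun c x => by rw [hf.map_smul, TensorProduct.smul_tmul']⟩

theorem lin_tmul_right {f : X → N} (m : M) (hf : IsLinearMap 𝕜 f) :
    IsLinearMap 𝕜 (fun x => m ⊗ₜ[𝕜] f x) :=
  ⟨fun x y => by rw [hf.map_add, TensorProduct.tmul_add],
    fun c x => by rw [hf.map_smul, TensorProduct.tmul_smul]⟩

theorem lin_smul {f : X → M} (c : 𝕜) (hf : IsLinearMap 𝕜 f) :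
    IsLinearMap 𝕜 (fun x => c • f x) :=
  ⟨fun x y => by rw [hf.map_add, smul_add], fun d x => by rw [hf.map_smul, smul_comm]⟩

theorem lin_sweedler_param {f : X → H → H → W} (h : H)
    (hf : ∀ a b, IsLinearMap 𝕜 (fun x => f x a b)) :
    IsLinearMap 𝕜 (fun x => sweedler 𝕜 h (fun a b => f x a b)) :=
  ⟨fun x y => by simp only [sweedler, (hf _ _).map_add, Finset.sum_add_distrib],
    fun c x => by simp only [sweedler, (hf _ _).map_smul, Finset.smul_sum]⟩

theorem lin_sweedler {f : H → H → W} {g : X → H} (hg : IsLinearMap 𝕜 g)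
    (h1 : ∀ b, IsLinearMap 𝕜 (fun a => f a b)) (h2 : ∀ a, IsLinearMap 𝕜 (fun b => f a b)) :
    IsLinearMap 𝕜 (fun x => sweedler 𝕜 (g x) (fun a b => f a b)) := by
  have : (fun x => sweedler 𝕜 (g x) (fun a b => f a b)) =
      fun x => (TensorProduct.lift (bil f h1 h2) ∘ₗ comul) (g x) := by
    funext x; exact sweedler_eq_bil f h1 h2 (g x)
  rw [this]; exact lin_map _ hg

end Lin

theorem map_sweedler {N : Type*} [AddCommGroup N] [Module 𝕜 N] (F : W →ₗ[𝕜] N) (f : H → H → W)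
    (h : H) : F (sweedler 𝕜 h f) = sweedler 𝕜 h (fun a b => F (f a b)) := by
  simp [sweedler]

/-- A linearity claim, proved by default by the tactic block below. -/
structure ByLin (p : Prop) : Prop where
  out : p := by
    repeat' first
      | intro _
      | apply And.intro
      | exact lin_id
      | apply lin_map
      | apply lin_app
      | apply lin_mul_left
      | apply lin_mul_right
      | apply lin_tmul_left
      | apply lin_tmul_right
      | apply lin_smul
      | apply lin_sweedler_param
      | apply lin_sweedler

theorem lin_apply_sweedler {N : Type*} [AddCommGroup N] [Module 𝕜 N] (F : W → N)
    (f : H → H → W) (h : H) (hF : ByLin (IsLinearMap 𝕜 F) := by exact {}) :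
    F (sweedler 𝕜 h f) = sweedler 𝕜 h (fun a b => F (f a b)) :=
  map_sweedler (hF.out.mk' F) f h

theorem sweedler_apply {M N : Type*} [AddCommGroup M] [Module 𝕜 M] [AddCommGroup N] [Module 𝕜 N]
    (f : H → H → M →ₗ[𝕜] N) (h : H) (m : M) :
    sweedler 𝕜 h f m = sweedler 𝕜 h (fun a b => f a b m) := by
  simp [sweedler]

theorem sweedler_comm (f : H → H → H → H → W) (h k : H) :
    sweedler 𝕜 h (fun a b => sweedler 𝕜 k (fun c d => f a b c d)) =
      sweedler 𝕜 k (fun c d => sweedler 𝕜 h (fun a b => f a b c d)) :=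
  Finset.sum_comm

theorem sweedler_congr (h : H) {f g : H → H → W} (hfg : ∀ a b, f a b = g a b) :
    sweedler 𝕜 h f = sweedler 𝕜 h g := by
  have : f = g := funext fun a => funext (hfg a)
  rw [this]

theorem sweedler_coassoc (f : H → H → H → W) (h : H)
    (hf : ByLin ((∀ b c, IsLinearMap 𝕜 (fun a => f a b c)) ∧
      (∀ a c, IsLinearMap 𝕜 (fun b => f a b c)) ∧
      (∀ a b, IsLinearMap 𝕜 (fun c => f a b c))) := by exact {}) :
    sweedler 𝕜 h (fun a b => sweedler 𝕜 a (fun c d => f c d b)) =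
      sweedler 𝕜 h (fun a b => sweedler 𝕜 b (fun c d => f a c d)) := by
  obtain ⟨h1, h2, h3⟩ := hf.out
  let G : H ⊗[𝕜] (H ⊗[𝕜] H) →ₗ[𝕜] W := TensorProduct.lift (IsLinearMap.mk'
    (fun a => TensorProduct.lift (bil (fun b c => f a b c) (h2 a) (h3 a)))
    ⟨fun x y => by ext; exact (h1 _ _).map_add _ _, fun c x => by ext; exact (h1 _ _).map_smul _ _⟩)
  have hG : ∀ a b c, G (a ⊗ₜ (b ⊗ₜ c)) = f a b c := fun a b c => rfl
  have := congrArg G (sum_tmul_tmul_eq (ℛ 𝕜 h) (fun i => ℛ 𝕜 _) (fun i => ℛ 𝕜 _))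
  simp only [map_sum, hG] at this
  exact this

theorem sweedler_regroup (f : H → H → H → H → W) (h : H)
    (hf : ByLin ((∀ b c d, IsLinearMap 𝕜 (fun a => f a b c d)) ∧
      (∀ a c d, IsLinearMap 𝕜 (fun b => f a b c d)) ∧
      (∀ a b d, IsLinearMap 𝕜 (fun c => f a b c d)) ∧
      (∀ a b c, IsLinearMap 𝕜 (fun d => f a b c d))) := by exact {}) :
    sweedler 𝕜 h (fun a b => sweedler 𝕜 b (fun c d => sweedler 𝕜 a (fun x y => f x y c d))) =
      sweedler 𝕜 h (fun a b => sweedler 𝕜 a (fun c d => sweedler 𝕜 d (fun x y => f c x y b))) := by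
  obtain ⟨h1, h2, h3, h4⟩ := hf.out
  rw [← sweedler_coassoc (fun a c d => sweedler 𝕜 a (fun x y => f x y c d)) h
    ⟨fun c d => lin_sweedler lin_id (fun y => h1 y c d) (fun x => h2 x c d),
      fun a d => lin_sweedler_param a (fun x y => h3 x y d),
      fun a c => lin_sweedler_param a (fun x y => h4 x y c)⟩]
  exact sweedler_congr _ fun a b => sweedler_coassoc (fun c x y => f c x y b) a
    ⟨fun x y => h1 x y b, fun c y => h2 c y b, fun c x => h3 c x b⟩

theorem sweedler_counit_left (f : H → W) (h : H)
    (hf : ByLin (IsLinearMap 𝕜 f) := by exact {}) :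
    sweedler 𝕜 h (fun a b => counit (R := 𝕜) a • f b) = f h := by
  have := congrArg (hf.out.mk' f) (sum_counit_smul (ℛ 𝕜 h))
  simp only [map_sum, map_smul] at this
  exact this

theorem sweedler_counit_right (f : H → W) (h : H)
    (hf : ByLin (IsLinearMap 𝕜 f) := by exact {}) :
    sweedler 𝕜 h (fun a b => counit (R := 𝕜) b • f a) = f h := by
  have := congrArg (TensorProduct.lift ((LinearMap.lsmul 𝕜 W).flip ∘ₗ hf.out.mk' f))
    (sum_tmul_counit_eq (R := 𝕜) (ℛ 𝕜 h))
  simp only [map_sum, TensorProduct.lift.tmul, LinearMap.comp_apply, LinearMap.flip_apply,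
    LinearMap.lsmul_apply, one_smul] at this
  exact this

theorem sweedler_one (f : H → H → W)
    (hf : ByLin ((∀ b, IsLinearMap 𝕜 (fun a => f a b)) ∧
      (∀ a, IsLinearMap 𝕜 (fun b => f a b))) := by exact {}) : sweedler 𝕜 1 f = f 1 1 := by
  rw [sweedler_eq_bil f hf.out.1 hf.out.2, Bialgebra.comul_one, Algebra.TensorProduct.one_def]; rfl

theorem sweedler_mul (f : H → H → W) (h k : H)
    (hf : ByLin ((∀ b, IsLinearMap 𝕜 (fun a => f a b)) ∧
      (∀ a, IsLinearMap 𝕜 (fun b => f a b))) := by exact {}) :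
    sweedler 𝕜 (h * k) f =
      sweedler 𝕜 h (fun a b => sweedler 𝕜 k (fun c d => f (a * c) (b * d))) := by
  rw [sweedler_eq_bil f hf.out.1 hf.out.2, Bialgebra.comul_mul, ← (ℛ 𝕜 h).eq, ← (ℛ 𝕜 k).eq,
    Finset.sum_mul_sum]
  simp only [map_sum, Algebra.TensorProduct.tmul_mul_tmul, TensorProduct.lift.tmul]
  rfl

theorem sweedler_antipode_left (f : H → W) (h : H)
    (hf : ByLin (IsLinearMap 𝕜 f) := by exact {}) :
    sweedler 𝕜 h (fun a b => f (antipode 𝕜 a * b)) = counit (R := 𝕜) h • f 1 := by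
  have := congrArg (hf.out.mk' f) (sum_antipode_mul_eq_smul (ℛ 𝕜 h))
  simp only [map_sum, map_smul] at this
  exact this

theorem sweedler_antipode_right (f : H → W) (h : H)
    (hf : ByLin (IsLinearMap 𝕜 f) := by exact {}) :
    sweedler 𝕜 h (fun a b => f (a * antipode 𝕜 b)) = counit (R := 𝕜) h • f 1 := by
  have := congrArg (hf.out.mk' f) (sum_mul_antipode_eq_smul (ℛ 𝕜 h))
  simp only [map_sum, map_smul] at this
  exact this

theorem comul_antipode (h : H) :
    comul (R := 𝕜) (antipode 𝕜 h) =
      sweedler 𝕜 h (fun a b => antipode 𝕜 b ⊗ₜ[𝕜] antipode 𝕜 a) := by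
  let Δ : H →ₗ[𝕜] H ⊗[𝕜] H := comul
  let S : H →ₗ[𝕜] H := antipode 𝕜
  have e1 : ∀ h : H, sweedler 𝕜 h (fun a b => Δ (S a) * Δ b) = counit (R := 𝕜) h • 1 := by
    intro h
    have := sweedler_antipode_left (𝕜 := 𝕜) (fun x => Δ x) h
    simp only [Δ, Bialgebra.comul_mul, Bialgebra.comul_one] at this
    exact this
  have e2 : ∀ h : H, sweedler 𝕜 h (fun a b => Δ a * sweedler 𝕜 b (fun c d => S d ⊗ₜ[𝕜] S c)) =
      counit (R := 𝕜) h • 1 := by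
    intro h
    have d0 : ∀ a : H, Δ a = sweedler 𝕜 a (fun c d => c ⊗ₜ[𝕜] d) := fun a => (ℛ 𝕜 a).eq.symm
    calc sweedler 𝕜 h (fun a b => Δ a * sweedler 𝕜 b (fun c d => S d ⊗ₜ[𝕜] S c))
        = sweedler 𝕜 h (fun a b => sweedler 𝕜 b (fun c d => sweedler 𝕜 a
            (fun e f => (e * S d) ⊗ₜ[𝕜] (f * S c)))) := by
          refine sweedler_congr _ fun a b => ?_
          rw [lin_apply_sweedler (fun x => Δ a * x)]
          refine sweedler_congr _ fun c d => ?_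
          rw [d0, lin_apply_sweedler (fun x => x * S d ⊗ₜ[𝕜] S c)]
          simp only [Algebra.TensorProduct.tmul_mul_tmul]
      _ = sweedler 𝕜 h (fun a b => sweedler 𝕜 a (fun c d => sweedler 𝕜 c
            (fun e f => (e * S b) ⊗ₜ[𝕜] (f * S d)))) :=
          (sweedler_coassoc (fun a c d => sweedler 𝕜 a
            (fun e f => (e * S d) ⊗ₜ[𝕜] (f * S c))) h).symm
      _ = sweedler 𝕜 h (fun a b => sweedler 𝕜 a (fun c d => sweedler 𝕜 d
            (fun e f => (c * S b) ⊗ₜ[𝕜] (e * S f)))) :=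
          sweedler_congr _ fun a b => sweedler_coassoc
            (fun c e f => (c * S b) ⊗ₜ[𝕜] (e * S f)) a
      _ = sweedler 𝕜 h (fun a b => sweedler 𝕜 a (fun c d => counit (R := 𝕜) d •
            ((c * S b) ⊗ₜ[𝕜] (1 : H)))) :=
          sweedler_congr _ fun a b => sweedler_congr _ fun c d =>
            sweedler_antipode_right (fun x => (c * S b) ⊗ₜ[𝕜] x) d
      _ = sweedler 𝕜 h (fun a b => (a * S b) ⊗ₜ[𝕜] (1 : H)) :=
          sweedler_congr _ fun a b => sweedler_counit_right (fun c => (c * S b) ⊗ₜ[𝕜] (1 : H)) a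
      _ = counit (R := 𝕜) h • 1 := sweedler_antipode_right (fun x => x ⊗ₜ[𝕜] (1 : H)) h
  calc comul (R := 𝕜) (antipode 𝕜 h)
      = sweedler 𝕜 h (fun a b => counit (R := 𝕜) b • Δ (S a)) :=
        (sweedler_counit_right (fun a => Δ (S a)) h).symm
    _ = sweedler 𝕜 h (fun a b => sweedler 𝕜 b (fun c d => Δ (S a) *
          (Δ c * sweedler 𝕜 d (fun e f => S f ⊗ₜ[𝕜] S e)))) := by
        refine sweedler_congr _ fun a b => ?_
        rw [← lin_apply_sweedler (fun x => Δ (S a) * x), e2, mul_smul_comm, mul_one]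
    _ = sweedler 𝕜 h (fun a b => sweedler 𝕜 a (fun c d => Δ (S c) *
          (Δ d * sweedler 𝕜 b (fun e f => S f ⊗ₜ[𝕜] S e)))) :=
        (sweedler_coassoc (fun a c d => Δ (S a) *
          (Δ c * sweedler 𝕜 d (fun e f => S f ⊗ₜ[𝕜] S e))) h).symm
    _ = sweedler 𝕜 h (fun a b => counit (R := 𝕜) a • sweedler 𝕜 b (fun e f => S f ⊗ₜ[𝕜] S e)) := by
        refine sweedler_congr _ fun a b => ?_
        simp only [← mul_assoc]
        rw [← lin_apply_sweedler (fun x => x * sweedler 𝕜 b (fun e f => S f ⊗ₜ[𝕜] S e)), e1,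
          smul_mul_assoc, one_mul]
    _ = _ := sweedler_counit_left (fun b => sweedler 𝕜 b (fun e f => S f ⊗ₜ[𝕜] S e)) h

theorem sweedler_antipode (f : H → H → W) (h : H)
    (hf : ByLin ((∀ b, IsLinearMap 𝕜 (fun a => f a b)) ∧
      (∀ a, IsLinearMap 𝕜 (fun b => f a b))) := by exact {}) :
    sweedler 𝕜 (antipode 𝕜 h) f = sweedler 𝕜 h (fun a b => f (antipode 𝕜 b) (antipode 𝕜 a)) := by
  rw [sweedler_eq_bil f hf.out.1 hf.out.2, comul_antipode, map_sweedler]; rfl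

/-- The inverse of a bijective antipode. -/
noncomputable def antipodeInv (hS : Function.Bijective (antipode 𝕜 : H →ₗ[𝕜] H)) : H →ₗ[𝕜] H :=
  (LinearEquiv.ofBijective (antipode 𝕜) hS).symm.toLinearMap

variable (hS : Function.Bijective (antipode 𝕜 : H →ₗ[𝕜] H))

theorem antipode_antipodeInv (h : H) : antipode 𝕜 (antipodeInv hS h) = h :=
  (LinearEquiv.ofBijective (antipode 𝕜 : H →ₗ[𝕜] H) hS).apply_symm_apply h

theorem antipodeInv_antipode (h : H) : antipodeInv hS (antipode 𝕜 h) = h :=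
  (LinearEquiv.ofBijective (antipode 𝕜 : H →ₗ[𝕜] H) hS).symm_apply_apply h

theorem antipodeInv_mul (a b : H) :
    antipodeInv hS (a * b) = antipodeInv hS b * antipodeInv hS a := by
  apply hS.1
  rw [antipode_mul_antidistrib, antipode_antipodeInv, antipode_antipodeInv, antipode_antipodeInv]

theorem antipodeInv_one : antipodeInv hS 1 = 1 := by
  apply hS.1
  rw [antipode_antipodeInv, antipode_one]

theorem sweedler_antipodeInv (f : H → H → W) (h : H)
    (hf : ByLin ((∀ b, IsLinearMap 𝕜 (fun a => f a b)) ∧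
      (∀ a, IsLinearMap 𝕜 (fun b => f a b))) := by exact {}) :
    sweedler 𝕜 (antipodeInv hS h) f =
      sweedler 𝕜 h (fun a b => f (antipodeInv hS b) (antipodeInv hS a)) := by
  obtain ⟨g, rfl⟩ := hS.2 h
  rw [antipodeInv_antipode, sweedler_antipode (fun a b => f (antipodeInv hS b) (antipodeInv hS a))
    g ⟨fun b => lin_comp (hf.out.2 _) (lin_map _ lin_id),
      fun a => lin_comp (hf.out.1 _) (lin_map _ lin_id)⟩]
  simp only [antipodeInv_antipode]

theorem sweedler_antipodeInv_left (f : H → W) (h : H)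
    (hf : ByLin (IsLinearMap 𝕜 f) := by exact {}) :
    sweedler 𝕜 h (fun a b => f (antipodeInv hS b * a)) = counit (R := 𝕜) h • f 1 := by
  have := sweedler_antipode_right (𝕜 := 𝕜) f (antipodeInv hS h) hf
  rw [sweedler_antipodeInv hS (fun a b => f (a * antipode 𝕜 b)) h
    ⟨fun b => lin_comp hf.out (lin_mul_left lin_id _),
      fun a => lin_comp hf.out (lin_mul_right _ (lin_map _ lin_id))⟩] at this
  simp only [antipode_antipodeInv] at this
  rw [this, ← counit_antipode (R := 𝕜) (antipodeInv hS h), antipode_antipodeInv]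

end Sweedler

section PartialRep

variable {𝕜 H B : Type*} [Field 𝕜] [Ring H] [HopfAlgebra 𝕜 H] [Ring B] [Algebra 𝕜 B]

/-- A partial representation of the Hopf algebra `H` in the unital algebra `B`:
`π(1) = 1`, `π(h) π(k₁) π(S(k₂)) = π(h k₁) π(S(k₂))` and
`π(h₁) π(S(h₂)) π(k) = π(h₁) π(S(h₂) k)`. -/
structure IsPartialRep (π : H →ₗ[𝕜] B) : Prop where
  map_one : π 1 = 1
  pr2 : ∀ h k : H, sweedler 𝕜 k (fun k₁ k₂ => π h * π k₁ * π (antipode 𝕜 k₂)) =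
    sweedler 𝕜 k (fun k₁ k₂ => π (h * k₁) * π (antipode 𝕜 k₂))
  pr3 : ∀ h k : H, sweedler 𝕜 h (fun h₁ h₂ => π h₁ * π (antipode 𝕜 h₂) * π k) =
    sweedler 𝕜 h (fun h₁ h₂ => π h₁ * π (antipode 𝕜 h₂ * k))

/-- The elements `ε_h = π(h₁) π(S(h₂))`. -/
noncomputable def epsL (π : H →ₗ[𝕜] B) : H →ₗ[𝕜] B :=
  IsLinearMap.mk' (fun h => sweedler 𝕜 h (fun h₁ h₂ => π h₁ * π (antipode 𝕜 h₂))) (ByLin.out {})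

/-- The elements `π(h₂) π(S⁻¹(h₁))`, through which `ε_h` acts on the right. -/
noncomputable def epsR (hS : Function.Bijective (antipode 𝕜 : H →ₗ[𝕜] H)) (π : H →ₗ[𝕜] B) :
    H →ₗ[𝕜] B :=
  IsLinearMap.mk' (fun h => sweedler 𝕜 h (fun h₁ h₂ => π h₂ * π (antipodeInv hS h₁)))
    (ByLin.out {})

theorem epsL_apply (π : H →ₗ[𝕜] B) (h : H) :
    epsL π h = sweedler 𝕜 h (fun h₁ h₂ => π h₁ * π (antipode 𝕜 h₂)) := rfl

theorem epsR_apply (hS : Function.Bijective (antipode 𝕜 : H →ₗ[𝕜] H)) (π : H →ₗ[𝕜] B) (h : H) :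
    epsR hS π h = sweedler 𝕜 h (fun h₁ h₂ => π h₂ * π (antipodeInv hS h₁)) := rfl

namespace IsPartialRep

variable {π : H →ₗ[𝕜] B}

theorem epsL_mul (hπ : IsPartialRep π) (h k : H) :
    epsL π h * π k = sweedler 𝕜 h (fun a b => π a * π (antipode 𝕜 b * k)) := by
  rw [epsL_apply, lin_apply_sweedler (fun x => x * π k), hπ.pr3]

theorem mul_epsL (hπ : IsPartialRep π) (h k : H) :
    π h * epsL π k = sweedler 𝕜 k (fun a b => π (h * a) * π (antipode 𝕜 b)) := by
  rw [epsL_apply, lin_apply_sweedler (fun x => π h * x), ← hπ.pr2]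
  simp only [mul_assoc]

theorem sweedler_epsL_mul (hπ : IsPartialRep π) (h : H) : sweedler 𝕜 h (fun a b => epsL π a * π b) = π h :=
  calc sweedler 𝕜 h (fun a b => epsL π a * π b)
      = sweedler 𝕜 h (fun a b => sweedler 𝕜 a (fun c d => π c * π (antipode 𝕜 d * b))) :=
        sweedler_congr _ fun a b => hπ.epsL_mul a b
    _ = sweedler 𝕜 h (fun a b => sweedler 𝕜 b (fun c d => π a * π (antipode 𝕜 c * d))) :=
        sweedler_coassoc (fun a c d => π a * π (antipode 𝕜 c * d)) h
    _ = sweedler 𝕜 h (fun a b => counit (R := 𝕜) b • (π a * π 1)) :=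
        sweedler_congr _ fun a b => sweedler_antipode_left (fun x => π a * π x) b
    _ = π h := by
        rw [sweedler_counit_right (fun a => π a * π 1), hπ.map_one, mul_one]

theorem sweedler_mul_epsL_antipode (hπ : IsPartialRep π) (h : H) :
    sweedler 𝕜 h (fun a b => π (antipode 𝕜 a) * epsL π b) = π (antipode 𝕜 h) :=
  calc sweedler 𝕜 h (fun a b => π (antipode 𝕜 a) * epsL π b)
      = sweedler 𝕜 h (fun a b => sweedler 𝕜 b
          (fun c d => π (antipode 𝕜 a * c) * π (antipode 𝕜 d))) :=
        sweedler_congr _ fun a b => hπ.mul_epsL _ b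
    _ = sweedler 𝕜 h (fun a b => sweedler 𝕜 a
          (fun c d => π (antipode 𝕜 c * d) * π (antipode 𝕜 b))) :=
        (sweedler_coassoc (fun a c d => π (antipode 𝕜 a * c) * π (antipode 𝕜 d)) h).symm
    _ = sweedler 𝕜 h (fun a b => counit (R := 𝕜) a • (π 1 * π (antipode 𝕜 b))) :=
        sweedler_congr _ fun a b => sweedler_antipode_left (fun x => π x * π (antipode 𝕜 b)) a
    _ = _ := by
        rw [sweedler_counit_left (fun b => π 1 * π (antipode 𝕜 b)), hπ.map_one, one_mul]

theorem pr4 (hπ : IsPartialRep π) (h k : H) : sweedler 𝕜 k (fun a b => π h * π (antipode 𝕜 a) * π b) =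
    sweedler 𝕜 k (fun a b => π (h * antipode 𝕜 a) * π b) :=
  Eq.symm <|
  calc sweedler 𝕜 k (fun a b => π (h * antipode 𝕜 a) * π b)
      = sweedler 𝕜 k (fun a b => sweedler 𝕜 b
          (fun c d => π (h * antipode 𝕜 a) * (epsL π c * π d))) := by
        refine sweedler_congr _ fun a b => ?_
        rw [← lin_apply_sweedler (fun x => π (h * antipode 𝕜 a) * x), hπ.sweedler_epsL_mul]
    _ = sweedler 𝕜 k (fun a b => sweedler 𝕜 a
          (fun c d => π (h * antipode 𝕜 c) * (epsL π d * π b))) :=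
        (sweedler_coassoc (fun a c d => π (h * antipode 𝕜 a) * (epsL π c * π d)) k).symm
    _ = sweedler 𝕜 k (fun a b => sweedler 𝕜 a (fun c d => sweedler 𝕜 d
          (fun e f => π (h * (antipode 𝕜 c * e)) * π (antipode 𝕜 f) * π b))) := by
        refine sweedler_congr _ fun a b => sweedler_congr _ fun c d => ?_
        rw [← mul_assoc, hπ.mul_epsL, lin_apply_sweedler (fun x => x * π b)]
        simp only [mul_assoc]
    _ = sweedler 𝕜 k (fun a b => sweedler 𝕜 a (fun c d => sweedler 𝕜 c
          (fun e f => π (h * (antipode 𝕜 e * f)) * π (antipode 𝕜 d) * π b))) :=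
        sweedler_congr _ fun a b => (sweedler_coassoc
          (fun c e f => π (h * (antipode 𝕜 c * e)) * π (antipode 𝕜 f) * π b) a).symm
    _ = sweedler 𝕜 k (fun a b => sweedler 𝕜 a (fun c d => counit (R := 𝕜) c •
          (π (h * 1) * π (antipode 𝕜 d) * π b))) :=
        sweedler_congr _ fun a b => sweedler_congr _ fun c d =>
          sweedler_antipode_left (fun x => π (h * x) * π (antipode 𝕜 d) * π b) c
    _ = sweedler 𝕜 k (fun a b => π (h * 1) * π (antipode 𝕜 a) * π b) :=
        sweedler_congr _ fun a b =>
          sweedler_counit_left (fun d => π (h * 1) * π (antipode 𝕜 d) * π b) a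
    _ = _ := by simp only [mul_one]

theorem pr5 (hπ : IsPartialRep π) (h k : H) : sweedler 𝕜 h (fun a b => π (antipode 𝕜 a) * π b * π k) =
    sweedler 𝕜 h (fun a b => π (antipode 𝕜 a) * π (b * k)) :=
  Eq.symm <|
  calc sweedler 𝕜 h (fun a b => π (antipode 𝕜 a) * π (b * k))
      = sweedler 𝕜 h (fun a b => sweedler 𝕜 a
          (fun c d => π (antipode 𝕜 c) * epsL π d * π (b * k))) := by
        refine sweedler_congr _ fun a b => ?_
        rw [← lin_apply_sweedler (fun x => x * π (b * k)), hπ.sweedler_mul_epsL_antipode]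
    _ = sweedler 𝕜 h (fun a b => sweedler 𝕜 b
          (fun c d => π (antipode 𝕜 a) * epsL π c * π (d * k))) :=
        sweedler_coassoc (fun a c d => π (antipode 𝕜 a) * epsL π c * π (d * k)) h
    _ = sweedler 𝕜 h (fun a b => sweedler 𝕜 b (fun c d => sweedler 𝕜 c
          (fun e f => π (antipode 𝕜 a) * (π e * π (antipode 𝕜 f * d * k))))) := by
        refine sweedler_congr _ fun a b => sweedler_congr _ fun c d => ?_
        rw [mul_assoc, hπ.epsL_mul, lin_apply_sweedler (fun x => π (antipode 𝕜 a) * x)]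
        simp only [mul_assoc]
    _ = sweedler 𝕜 h (fun a b => sweedler 𝕜 b (fun c d => sweedler 𝕜 d
          (fun e f => π (antipode 𝕜 a) * (π c * π (antipode 𝕜 e * f * k))))) :=
        sweedler_congr _ fun a b => sweedler_coassoc
          (fun c e f => π (antipode 𝕜 a) * (π c * π (antipode 𝕜 e * f * k))) b
    _ = sweedler 𝕜 h (fun a b => sweedler 𝕜 b (fun c d => counit (R := 𝕜) d •
          (π (antipode 𝕜 a) * (π c * π (1 * k))))) :=
        sweedler_congr _ fun a b => sweedler_congr _ fun c d =>
          sweedler_antipode_left (fun x => π (antipode 𝕜 a) * (π c * π (x * k))) d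
    _ = sweedler 𝕜 h (fun a b => π (antipode 𝕜 a) * (π b * π (1 * k))) :=
        sweedler_congr _ fun a b =>
          sweedler_counit_right (fun c => π (antipode 𝕜 a) * (π c * π (1 * k))) b
    _ = _ := by simp only [one_mul, mul_assoc]

variable (hS : Function.Bijective (antipode 𝕜 : H →ₗ[𝕜] H))

theorem mul_epsR (hπ : IsPartialRep π) (h k : H) :
    π h * epsR hS π k = sweedler 𝕜 k (fun a b => π (h * b) * π (antipodeInv hS a)) := by
  have := hπ.pr4 h (antipodeInv hS k)
  rw [sweedler_antipodeInv hS (fun a b => π h * π (antipode 𝕜 a) * π b),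
    sweedler_antipodeInv hS (fun a b => π (h * antipode 𝕜 a) * π b)] at this
  simp only [antipode_antipodeInv] at this
  rw [← this, epsR_apply, lin_apply_sweedler (fun x => π h * x)]
  simp only [mul_assoc]

theorem epsR_mul (hπ : IsPartialRep π) (h k : H) :
    epsR hS π h * π k = sweedler 𝕜 h (fun a b => π b * π (antipodeInv hS a * k)) := by
  have := hπ.pr5 (antipodeInv hS h) k
  rw [sweedler_antipodeInv hS (fun a b => π (antipode 𝕜 a) * π b * π k),
    sweedler_antipodeInv hS (fun a b => π (antipode 𝕜 a) * π (b * k))] at this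
  simp only [antipode_antipodeInv] at this
  rw [← this, epsR_apply, lin_apply_sweedler (fun x => x * π k)]

theorem sweedler_epsL_mul_mul (hπ : IsPartialRep π) (h k : H) :
    sweedler 𝕜 h (fun a b => epsL π (a * k) * π b) = π h * epsL π k :=
  calc sweedler 𝕜 h (fun a b => epsL π (a * k) * π b)
      = sweedler 𝕜 h (fun a b => sweedler 𝕜 a (fun c d => sweedler 𝕜 k (fun e f =>
          π (c * e) * π (antipode 𝕜 f * (antipode 𝕜 d * b))))) := by
        refine sweedler_congr _ fun a b => ?_
        rw [hπ.epsL_mul, sweedler_mul (fun c d => π c * π (antipode 𝕜 d * b))]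
        simp only [antipode_mul_antidistrib, mul_assoc]
    _ = sweedler 𝕜 h (fun a b => sweedler 𝕜 b (fun c d => sweedler 𝕜 k (fun e f =>
          π (a * e) * π (antipode 𝕜 f * (antipode 𝕜 c * d))))) :=
        sweedler_coassoc (fun a c d => sweedler 𝕜 k (fun e f =>
          π (a * e) * π (antipode 𝕜 f * (antipode 𝕜 c * d)))) h
    _ = sweedler 𝕜 h (fun a b => counit (R := 𝕜) b • sweedler 𝕜 k (fun e f =>
          π (a * e) * π (antipode 𝕜 f * 1))) :=
        sweedler_congr _ fun a b => sweedler_antipode_left (fun x => sweedler 𝕜 k (fun e f =>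
          π (a * e) * π (antipode 𝕜 f * x))) b
    _ = sweedler 𝕜 k (fun e f => π (h * e) * π (antipode 𝕜 f * 1)) :=
        sweedler_counit_right (fun a => sweedler 𝕜 k (fun e f =>
          π (a * e) * π (antipode 𝕜 f * 1))) h
    _ = π h * epsL π k := by rw [hπ.mul_epsL]; simp only [mul_one]

theorem sweedler_epsR_mul_mul (hπ : IsPartialRep π) (h k : H) :
    sweedler 𝕜 h (fun a b => epsR hS π (b * k) * π a) = π h * epsR hS π k :=
  calc sweedler 𝕜 h (fun a b => epsR hS π (b * k) * π a)
      = sweedler 𝕜 h (fun a b => sweedler 𝕜 b (fun c d => sweedler 𝕜 k (fun e f =>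
          π (d * f) * π (antipodeInv hS e * (antipodeInv hS c * a))))) := by
        refine sweedler_congr _ fun a b => ?_
        rw [hπ.epsR_mul, sweedler_mul (fun c d => π d * π (antipodeInv hS c * a))]
        simp only [antipodeInv_mul, mul_assoc]
    _ = sweedler 𝕜 h (fun a b => sweedler 𝕜 a (fun c d => sweedler 𝕜 k (fun e f =>
          π (b * f) * π (antipodeInv hS e * (antipodeInv hS d * c))))) :=
        (sweedler_coassoc (fun a c d => sweedler 𝕜 k (fun e f =>
          π (d * f) * π (antipodeInv hS e * (antipodeInv hS c * a)))) h).symm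
    _ = sweedler 𝕜 h (fun a b => counit (R := 𝕜) a • sweedler 𝕜 k (fun e f =>
          π (b * f) * π (antipodeInv hS e * 1))) :=
        sweedler_congr _ fun a b => sweedler_antipodeInv_left hS (fun x => sweedler 𝕜 k
          (fun e f => π (b * f) * π (antipodeInv hS e * x))) a
    _ = sweedler 𝕜 k (fun e f => π (h * f) * π (antipodeInv hS e * 1)) :=
        sweedler_counit_left (fun b => sweedler 𝕜 k (fun e f =>
          π (b * f) * π (antipodeInv hS e * 1))) h
    _ = π h * epsR hS π k := by rw [hπ.mul_epsR]; simp only [mul_one]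

theorem sweedler_epsR_mul (hπ : IsPartialRep π) (h : H) :
    sweedler 𝕜 h (fun a b => epsR hS π b * π a) = π h := by
  have := hπ.sweedler_epsR_mul_mul hS h 1
  simp only [mul_one] at this
  rw [this, epsR_apply, sweedler_one (fun a b => π b * π (antipodeInv hS a)), antipodeInv_one,
    hπ.map_one, mul_one, mul_one]


/-- `h ↦ π(S⁻¹(h))` is a partial representation in the opposite algebra. -/
theorem opposite (hπ : IsPartialRep π) : IsPartialRep
    ((MulOpposite.opLinearEquiv 𝕜 : B ≃ₗ[𝕜] Bᵐᵒᵖ).toLinearMap ∘ₗ π ∘ₗ antipodeInv hS) where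
  map_one := by simp [antipodeInv_one, hπ.map_one]
  pr2 h k := by
    have := congrArg (MulOpposite.opLinearEquiv 𝕜 : B ≃ₗ[𝕜] Bᵐᵒᵖ).toLinearMap
      (hπ.epsR_mul hS k (antipodeInv hS h))
    rw [epsR_apply, lin_apply_sweedler (fun x => x * π (antipodeInv hS h)), map_sweedler,
      map_sweedler] at this
    simp only [LinearMap.comp_apply, LinearEquiv.coe_coe, MulOpposite.coe_opLinearEquiv,
      antipodeInv_antipode, antipodeInv_mul, MulOpposite.op_mul, mul_assoc] at this ⊢
    exact this
  pr3 h k := by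
    have := congrArg (MulOpposite.opLinearEquiv 𝕜 : B ≃ₗ[𝕜] Bᵐᵒᵖ).toLinearMap
      (hπ.mul_epsR hS (antipodeInv hS k) h)
    rw [epsR_apply, lin_apply_sweedler (fun x => π (antipodeInv hS k) * x), map_sweedler,
      map_sweedler] at this
    simp only [LinearMap.comp_apply, LinearEquiv.coe_coe, MulOpposite.coe_opLinearEquiv,
      antipodeInv_antipode, antipodeInv_mul, MulOpposite.op_mul, mul_assoc] at this ⊢
    exact this

end IsPartialRep

end PartialRep

section Hpar

variable (𝕜 H : Type*) [Field 𝕜] [Ring H] [HopfAlgebra 𝕜 H]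

/-- The defining relations of the universal algebra of partial representations of `H`. -/
inductive HparRel : TensorAlgebra 𝕜 H → TensorAlgebra 𝕜 H → Prop
  | one : HparRel (TensorAlgebra.ι 𝕜 (1 : H)) 1
  | pr2 (h k : H) : HparRel
      (sweedler 𝕜 k (fun k₁ k₂ => TensorAlgebra.ι 𝕜 h * TensorAlgebra.ι 𝕜 k₁ *
        TensorAlgebra.ι 𝕜 (antipode 𝕜 k₂)))
      (sweedler 𝕜 k (fun k₁ k₂ => TensorAlgebra.ι 𝕜 (h * k₁) *
        TensorAlgebra.ι 𝕜 (antipode 𝕜 k₂)))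
  | pr3 (h k : H) : HparRel
      (sweedler 𝕜 h (fun h₁ h₂ => TensorAlgebra.ι 𝕜 h₁ * TensorAlgebra.ι 𝕜 (antipode 𝕜 h₂) *
        TensorAlgebra.ι 𝕜 k))
      (sweedler 𝕜 h (fun h₁ h₂ => TensorAlgebra.ι 𝕜 h₁ *
        TensorAlgebra.ι 𝕜 (antipode 𝕜 h₂ * k)))

/-- The universal algebra `H_par` of partial representations of `H`. -/
abbrev Hpar : Type _ := RingQuot (HparRel 𝕜 H)

/-- The universal partial representation `h ↦ [h]` of `H` in `H_par`. -/
noncomputable def bracket : H →ₗ[𝕜] Hpar 𝕜 H :=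
  (RingQuot.mkAlgHom 𝕜 (HparRel 𝕜 H)).toLinearMap ∘ₗ TensorAlgebra.ι 𝕜

theorem isPartialRep_bracket : IsPartialRep (bracket 𝕜 H) where
  map_one := by
    have := RingQuot.mkAlgHom_rel 𝕜 (HparRel.one (𝕜 := 𝕜) (H := H))
    simpa [bracket] using this
  pr2 h k := by
    have := RingQuot.mkAlgHom_rel 𝕜 (HparRel.pr2 (𝕜 := 𝕜) h k)
    simp only [← AlgHom.toLinearMap_apply, map_sweedler] at this
    simpa [bracket] using this
  pr3 h k := by
    have := RingQuot.mkAlgHom_rel 𝕜 (HparRel.pr3 (𝕜 := 𝕜) h k)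
    simp only [← AlgHom.toLinearMap_apply, map_sweedler] at this
    simpa [bracket] using this

variable {𝕜 H}

/-- The algebra morphism `H_par → B` induced by a partial representation. -/
noncomputable def hparLift {B : Type*} [Ring B] [Algebra 𝕜 B] {π : H →ₗ[𝕜] B}
    (hπ : IsPartialRep π) : Hpar 𝕜 H →ₐ[𝕜] B :=
  RingQuot.liftAlgHom 𝕜 ⟨TensorAlgebra.lift 𝕜 π, by
    intro x y hxy
    induction hxy with
    | one => simp [hπ.map_one]
    | pr2 h k =>
      simp only [← AlgHom.toLinearMap_apply, map_sweedler]
      simpa using hπ.pr2 h k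
    | pr3 h k =>
      simp only [← AlgHom.toLinearMap_apply, map_sweedler]
      simpa using hπ.pr3 h k⟩

theorem hparLift_bracket {B : Type*} [Ring B] [Algebra 𝕜 B] {π : H →ₗ[𝕜] B}
    (hπ : IsPartialRep π) (h : H) : hparLift hπ (bracket 𝕜 H h) = π h := by
  simp [hparLift, bracket]

variable (𝕜 H) in
/-- The base algebra `A`: the subalgebra of `H_par` generated by the elements
`ε_h = [h₁][S(h₂)]`. -/
noncomputable def baseAlgebra : Subalgebra 𝕜 (Hpar 𝕜 H) :=
  Algebra.adjoin 𝕜 (Set.range (epsL (bracket 𝕜 H)))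

/-- The algebra morphism `H_par → H_parᵒᵖ`, `[h] ↦ [S⁻¹(h)]`. -/
noncomputable def hparOp (hS : Function.Bijective (antipode 𝕜 : H →ₗ[𝕜] H)) :
    Hpar 𝕜 H →ₐ[𝕜] (Hpar 𝕜 H)ᵐᵒᵖ :=
  hparLift ((isPartialRep_bracket 𝕜 H).opposite hS)

/-- The target map `t`, the restriction to `A` of the algebra antimorphism `[h] ↦ [S⁻¹(h)]`
of `H_par`. It is the antimorphism with `t(ε_h) = [h₂][S⁻¹(h₁)]`. -/
noncomputable def target (hS : Function.Bijective (antipode 𝕜 : H →ₗ[𝕜] H))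
    (a : baseAlgebra 𝕜 H) : Hpar 𝕜 H :=
  (hparOp hS (a : Hpar 𝕜 H)).unop

theorem hparOp_epsL (hS : Function.Bijective (antipode 𝕜 : H →ₗ[𝕜] H)) (h : H) :
    (hparOp hS (epsL (bracket 𝕜 H) h)).unop = epsR hS (bracket 𝕜 H) h := by
  apply MulOpposite.op_injective
  rw [MulOpposite.op_unop, epsL_apply, epsR_apply, ← AlgHom.toLinearMap_apply, map_sweedler,
    ← MulOpposite.coe_opLinearEquiv 𝕜, ← LinearEquiv.coe_coe, map_sweedler]
  simp only [AlgHom.toLinearMap_apply, map_mul, hparOp, hparLift_bracket]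
  simp [antipodeInv_antipode]

end Hpar

section Modules

variable {𝕜 H : Type*} [Field 𝕜] [Ring H] [HopfAlgebra 𝕜 H]

variable (𝕜 H) in
/-- The structure of a partial `H`-module on the vector space `M`: a partial representation
of `H` in `End(M)`. The action is `h • m = π h m`. -/
structure PartialModule (M : Type*) [AddCommGroup M] [Module 𝕜 M] where
  π : H →ₗ[𝕜] Module.End 𝕜 M
  isPartialRep : IsPartialRep π

namespace PartialModule

variable {M N L M' N' : Type*} [AddCommGroup M] [Module 𝕜 M] [AddCommGroup N] [Module 𝕜 N]
  [AddCommGroup L] [Module 𝕜 L] [AddCommGroup M'] [Module 𝕜 M'] [AddCommGroup N'] [Module 𝕜 N']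

/-- A morphism of partial `H`-modules. -/
structure Hom (P : PartialModule 𝕜 H M) (Q : PartialModule 𝕜 H N) where
  toLin : M →ₗ[𝕜] N
  map_act : ∀ (h : H) (m : M), toLin (P.π h m) = Q.π h (toLin m)

/-- The identity morphism. -/
def Hom.id (P : PartialModule 𝕜 H M) : Hom P P := ⟨LinearMap.id, fun _ _ => rfl⟩

/-- Composition of morphisms, in diagrammatic order. -/
def Hom.comp {P : PartialModule 𝕜 H M} {Q : PartialModule 𝕜 H N} {R : PartialModule 𝕜 H L}
    (f : Hom P Q) (g : Hom Q R) : Hom P R :=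
  ⟨g.toLin ∘ₗ f.toLin, fun h m => by simp [f.map_act, g.map_act]⟩

/-- The `H_par`-module structure of a partial `H`-module. -/
noncomputable def hparAct (P : PartialModule 𝕜 H M) : Hpar 𝕜 H →ₐ[𝕜] Module.End 𝕜 M :=
  hparLift P.isPartialRep

theorem hparAct_epsL (P : PartialModule 𝕜 H M) (h : H) :
    P.hparAct (epsL (bracket 𝕜 H) h) = epsL P.π h := by
  rw [epsL_apply, epsL_apply, ← AlgHom.toLinearMap_apply, map_sweedler]
  simp only [AlgHom.toLinearMap_apply, map_mul, hparAct, hparLift_bracket]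

theorem hparAct_epsR (hS : Function.Bijective (antipode 𝕜 : H →ₗ[𝕜] H))
    (P : PartialModule 𝕜 H M) (h : H) :
    P.hparAct (epsR hS (bracket 𝕜 H) h) = epsR hS P.π h := by
  rw [epsR_apply, epsR_apply, ← AlgHom.toLinearMap_apply, map_sweedler]
  simp only [AlgHom.toLinearMap_apply, map_mul, hparAct, hparLift_bracket]

/-- The left `A`-module structure `a m` of a partial `H`-module. -/
noncomputable def leftAct (P : PartialModule 𝕜 H M) (a : baseAlgebra 𝕜 H) (m : M) : M :=
  P.hparAct (a : Hpar 𝕜 H) m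

/-- The right `A`-module structure `m a = t(a) m` of a partial `H`-module. -/
noncomputable def rightAct (hS : Function.Bijective (antipode 𝕜 : H →ₗ[𝕜] H))
    (P : PartialModule 𝕜 H M) (m : M) (a : baseAlgebra 𝕜 H) : M :=
  P.hparAct (target hS a) m

variable (hS : Function.Bijective (antipode 𝕜 : H →ₗ[𝕜] H))

/-- The subspace of `M ⊗ N` generated by the elements `m a ⊗ n - m ⊗ a n` with `a ∈ A`. -/
def balance (P : PartialModule 𝕜 H M) (Q : PartialModule 𝕜 H N) : Submodule 𝕜 (M ⊗[𝕜] N) :=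
  Submodule.span 𝕜 {x | ∃ (a : baseAlgebra 𝕜 H) (m : M) (n : N),
    x = P.rightAct hS m a ⊗ₜ[𝕜] n - m ⊗ₜ[𝕜] Q.leftAct a n}

/-- The vector space `M ⊗_A N`. -/
def TensorA (P : PartialModule 𝕜 H M) (Q : PartialModule 𝕜 H N) : Type _ :=
  (M ⊗[𝕜] N) ⧸ balance hS P Q

noncomputable instance (P : PartialModule 𝕜 H M) (Q : PartialModule 𝕜 H N) :
    AddCommGroup (TensorA hS P Q) :=
  inferInstanceAs (AddCommGroup ((M ⊗[𝕜] N) ⧸ balance hS P Q))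

noncomputable instance (P : PartialModule 𝕜 H M) (Q : PartialModule 𝕜 H N) :
    Module 𝕜 (TensorA hS P Q) :=
  inferInstanceAs (Module 𝕜 ((M ⊗[𝕜] N) ⧸ balance hS P Q))

/-- The universal balanced map `(m, n) ↦ m ⊗_A n`. -/
noncomputable def tmulA (P : PartialModule 𝕜 H M) (Q : PartialModule 𝕜 H N) :
    M →ₗ[𝕜] N →ₗ[𝕜] TensorA hS P Q :=
  TensorProduct.curry (show M ⊗[𝕜] N →ₗ[𝕜] TensorA hS P Q from (balance hS P Q).mkQ)

variable (P : PartialModule 𝕜 H M) (Q : PartialModule 𝕜 H N) (R : PartialModule 𝕜 H L)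

theorem tensorA_ext {W : Type*} [AddCommGroup W] [Module 𝕜 W] {f g : TensorA hS P Q →ₗ[𝕜] W}
    (hfg : ∀ m n, f (tmulA hS P Q m n) = g (tmulA hS P Q m n)) : f = g := by
  exact Submodule.linearMap_qext (M₂ := W) (balance hS P Q) (TensorProduct.ext' hfg)

/-- A bilinear map that is balanced with respect to the elements `ε_h` is `A`-balanced. -/
theorem balanced_of_eps {W : Type*} [AddCommGroup W] [Module 𝕜 W] (f : M →ₗ[𝕜] N →ₗ[𝕜] W)
    (hf : ∀ h m n, f (epsR hS P.π h m) n = f m (epsL Q.π h n)) (a : baseAlgebra 𝕜 H) (m : M)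
    (n : N) : f (P.rightAct hS m a) n = f m (Q.leftAct a n) := by
  obtain ⟨a, ha⟩ := a
  simp only [rightAct, leftAct, target]
  induction ha using Algebra.adjoin_induction generalizing m n with
  | mem x hx =>
    obtain ⟨h, rfl⟩ := hx
    rw [hparOp_epsL, hparAct_epsL, hparAct_epsR, hf]
  | algebraMap r =>
    rw [AlgHom.commutes, MulOpposite.algebraMap_apply, MulOpposite.unop_op, AlgHom.commutes,
      AlgHom.commutes, Module.algebraMap_end_apply, Module.algebraMap_end_apply]
    simp
  | add x y hx hy ihx ihy => simp [ihx, ihy]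
  | mul x y hx hy ihx ihy =>
    rw [map_mul, MulOpposite.unop_mul, map_mul, map_mul, Module.End.mul_apply,
      Module.End.mul_apply, ihy, ihx]

theorem tmulA_balanced (a : baseAlgebra 𝕜 H) (m : M) (n : N) :
    tmulA hS P Q (P.rightAct hS m a) n = tmulA hS P Q m (Q.leftAct a n) :=
  (Submodule.Quotient.eq _).2 (Submodule.subset_span ⟨a, m, n, rfl⟩)

theorem tmulA_eps (h : H) (m : M) (n : N) :
    tmulA hS P Q (epsR hS P.π h m) n = tmulA hS P Q m (epsL Q.π h n) := by
  have := tmulA_balanced hS P Q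
    ⟨epsL (bracket 𝕜 H) h, Algebra.subset_adjoin ⟨h, rfl⟩⟩ m n
  simpa only [rightAct, leftAct, target, hparOp_epsL, hparAct_epsL, hparAct_epsR] using this

/-- The linear map on `M ⊗_A N` induced by a balanced bilinear map. -/
def liftA {W : Type*} [AddCommGroup W] [Module 𝕜 W] (f : M →ₗ[𝕜] N →ₗ[𝕜] W)
    (hf : ∀ h m n, f (epsR hS P.π h m) n = f m (epsL Q.π h n)) : TensorA hS P Q →ₗ[𝕜] W :=
  (balance hS P Q).liftQ (TensorProduct.lift f) (Submodule.span_le.2 (by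
    rintro x ⟨a, m, n, rfl⟩
    simp [balanced_of_eps hS P Q f hf a m n]))

theorem liftA_tmulA {W : Type*} [AddCommGroup W] [Module 𝕜 W] (f : M →ₗ[𝕜] N →ₗ[𝕜] W)
    (hf : ∀ h m n, f (epsR hS P.π h m) n = f m (epsL Q.π h n)) (m : M) (n : N) :
    liftA hS P Q f hf (tmulA hS P Q m n) = f m n := rfl

/-- The map `(m, n) ↦ ∑ h₁ • m ⊗_A h₂ • n`. -/
noncomputable def diag (h : H) : M →ₗ[𝕜] N →ₗ[𝕜] TensorA hS P Q :=
  sweedler 𝕜 h (fun h₁ h₂ => (tmulA hS P Q).compl₁₂ (P.π h₁) (Q.π h₂))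

theorem diag_apply (h : H) (m : M) (n : N) :
    diag hS P Q h m n = sweedler 𝕜 h (fun h₁ h₂ => tmulA hS P Q (P.π h₁ m) (Q.π h₂ n)) := by
  rw [diag, sweedler_apply, sweedler_apply]; rfl

theorem diag_balanced (h k : H) (m : M) (n : N) :
    diag hS P Q h (epsR hS P.π k m) n = diag hS P Q h m (epsL Q.π k n) := by
  rw [diag_apply, diag_apply]
  calc sweedler 𝕜 h (fun a b => tmulA hS P Q (P.π a (epsR hS P.π k m)) (Q.π b n))
      = sweedler 𝕜 h (fun a b => sweedler 𝕜 a (fun c d =>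
          tmulA hS P Q (P.π c m) (epsL Q.π (d * k) (Q.π b n)))) := by
        refine sweedler_congr _ fun a b => ?_
        rw [← Module.End.mul_apply, ← P.isPartialRep.sweedler_epsR_mul_mul hS, sweedler_apply,
          lin_apply_sweedler (fun x => tmulA hS P Q x (Q.π b n))]
        simp only [Module.End.mul_apply, tmulA_eps]
    _ = sweedler 𝕜 h (fun a b => sweedler 𝕜 b (fun c d =>
          tmulA hS P Q (P.π a m) (epsL Q.π (c * k) (Q.π d n)))) :=
        sweedler_coassoc (fun a c d => tmulA hS P Q (P.π a m) (epsL Q.π (c * k) (Q.π d n))) h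
    _ = sweedler 𝕜 h (fun a b => tmulA hS P Q (P.π a m) (Q.π b (epsL Q.π k n))) := by
        refine sweedler_congr _ fun a b => ?_
        rw [← Module.End.mul_apply (Q.π b), ← Q.isPartialRep.sweedler_epsL_mul_mul,
          sweedler_apply, lin_apply_sweedler (fun x => tmulA hS P Q (P.π a m) x)]
        simp only [Module.End.mul_apply]

/-- The diagonal action on `M ⊗_A N`, `h • (m ⊗_A n) = ∑ h₁ • m ⊗_A h₂ • n`. -/
noncomputable def tensorπ : H →ₗ[𝕜] Module.End 𝕜 (TensorA hS P Q) :=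
  IsLinearMap.mk' (fun h => liftA hS P Q (diag hS P Q h) (diag_balanced hS P Q h))
    ⟨fun x y => tensorA_ext hS P Q fun m n => by
        rw [LinearMap.add_apply]
        simp only [liftA_tmulA, diag_apply]
        exact (ByLin.out {} : IsLinearMap 𝕜 (fun h => sweedler 𝕜 h
          (fun h₁ h₂ => tmulA hS P Q (P.π h₁ m) (Q.π h₂ n)))).map_add x y,
      fun c x => tensorA_ext hS P Q fun m n => by
        rw [LinearMap.smul_apply]
        simp only [liftA_tmulA, diag_apply]
        exact (ByLin.out {} : IsLinearMap 𝕜 (fun h => sweedler 𝕜 h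
          (fun h₁ h₂ => tmulA hS P Q (P.π h₁ m) (Q.π h₂ n)))).map_smul c x⟩

theorem tensorπ_tmulA (h : H) (m : M) (n : N) : tensorπ hS P Q h (tmulA hS P Q m n) =
    sweedler 𝕜 h (fun h₁ h₂ => tmulA hS P Q (P.π h₁ m) (Q.π h₂ n)) :=
  diag_apply hS P Q h m n


theorem tmulA_sweedler_eps (h : H) (m : M) (n : N) :
    sweedler 𝕜 h (fun a b => tmulA hS P Q (P.π a m) (epsL Q.π b n)) =
      tmulA hS P Q (P.π h m) n := by
  rw [← P.isPartialRep.sweedler_epsR_mul hS h, sweedler_apply,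
    lin_apply_sweedler (fun x => tmulA hS P Q x n)]
  simp only [Module.End.mul_apply, tmulA_eps]

theorem epsL_tensorπ (h : H) (m : M) (n : N) :
    epsL (tensorπ hS P Q) h (tmulA hS P Q m n) = tmulA hS P Q (epsL P.π h m) n := by
  rw [epsL_apply, sweedler_apply]
  calc sweedler 𝕜 h (fun a b =>
        (tensorπ hS P Q a * tensorπ hS P Q (antipode 𝕜 b)) (tmulA hS P Q m n))
      = sweedler 𝕜 h (fun a b => sweedler 𝕜 b (fun c d => sweedler 𝕜 a (fun x y =>
          tmulA hS P Q (P.π x (P.π (antipode 𝕜 d) m)) (Q.π y (Q.π (antipode 𝕜 c) n))))) := by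
        refine sweedler_congr _ fun a b => ?_
        rw [Module.End.mul_apply, tensorπ_tmulA,
          sweedler_antipode (fun c d => tmulA hS P Q (P.π c m) (Q.π d n)), map_sweedler]
        simp only [tensorπ_tmulA]
    _ = sweedler 𝕜 h (fun a b => sweedler 𝕜 a (fun c d => sweedler 𝕜 d (fun x y =>
          tmulA hS P Q (P.π c (P.π (antipode 𝕜 b) m)) (Q.π x (Q.π (antipode 𝕜 y) n))))) :=
        sweedler_regroup (fun x y c d =>
          tmulA hS P Q (P.π x (P.π (antipode 𝕜 d) m)) (Q.π y (Q.π (antipode 𝕜 c) n))) h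
    _ = sweedler 𝕜 h (fun a b => tmulA hS P Q (P.π a (P.π (antipode 𝕜 b) m)) n) := by
        refine sweedler_congr _ fun a b => ?_
        rw [← tmulA_sweedler_eps]
        refine sweedler_congr _ fun c d => ?_
        rw [epsL_apply, sweedler_apply, map_sweedler]
        simp only [Module.End.mul_apply]
    _ = tmulA hS P Q (epsL P.π h m) n := by
        rw [epsL_apply, sweedler_apply, lin_apply_sweedler (fun x => tmulA hS P Q x n)]
        simp only [Module.End.mul_apply]

theorem epsR_tensorπ (h : H) (m : M) (n : N) :
    epsR hS (tensorπ hS P Q) h (tmulA hS P Q m n) = tmulA hS P Q m (epsR hS Q.π h n) := by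
  rw [epsR_apply, sweedler_apply]
  calc sweedler 𝕜 h (fun a b =>
        (tensorπ hS P Q b * tensorπ hS P Q (antipodeInv hS a)) (tmulA hS P Q m n))
      = sweedler 𝕜 h (fun a b => sweedler 𝕜 a (fun c d => sweedler 𝕜 b (fun x y =>
          tmulA hS P Q (P.π x (P.π (antipodeInv hS d) m))
            (Q.π y (Q.π (antipodeInv hS c) n))))) := by
        refine sweedler_congr _ fun a b => ?_
        rw [Module.End.mul_apply, tensorπ_tmulA,
          sweedler_antipodeInv hS (fun c d => tmulA hS P Q (P.π c m) (Q.π d n)), map_sweedler]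
        simp only [tensorπ_tmulA]
    _ = sweedler 𝕜 h (fun a b => sweedler 𝕜 b (fun c d => sweedler 𝕜 d (fun x y =>
          tmulA hS P Q (P.π x (P.π (antipodeInv hS c) m))
            (Q.π y (Q.π (antipodeInv hS a) n))))) :=
        sweedler_coassoc (fun c d b => sweedler 𝕜 b (fun x y =>
          tmulA hS P Q (P.π x (P.π (antipodeInv hS d) m))
            (Q.π y (Q.π (antipodeInv hS c) n)))) h
    _ = sweedler 𝕜 h (fun a b => sweedler 𝕜 b (fun c d => sweedler 𝕜 c (fun x y =>
          tmulA hS P Q (P.π y (P.π (antipodeInv hS x) m))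
            (Q.π d (Q.π (antipodeInv hS a) n))))) :=
        sweedler_congr _ fun a b => (sweedler_coassoc (fun c x y =>
          tmulA hS P Q (P.π x (P.π (antipodeInv hS c) m))
            (Q.π y (Q.π (antipodeInv hS a) n))) b).symm
    _ = sweedler 𝕜 h (fun a b => tmulA hS P Q m (Q.π b (Q.π (antipodeInv hS a) n))) := by
        refine sweedler_congr _ fun a b => ?_
        rw [← Q.isPartialRep.sweedler_epsL_mul b, sweedler_apply,
          lin_apply_sweedler (fun x => tmulA hS P Q m x)]
        refine sweedler_congr _ fun c d => ?_
        rw [Module.End.mul_apply, ← tmulA_eps, epsR_apply, sweedler_apply,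
          lin_apply_sweedler (fun x => tmulA hS P Q x (Q.π d (Q.π (antipodeInv hS a) n)))]
        simp only [Module.End.mul_apply]
    _ = tmulA hS P Q m (epsR hS Q.π h n) := by
        rw [epsR_apply, sweedler_apply, map_sweedler]
        simp only [Module.End.mul_apply]

theorem tensorπ_one : tensorπ hS P Q 1 = 1 := by
  refine tensorA_ext hS P Q fun m n => ?_
  rw [tensorπ_tmulA, sweedler_one (fun a b => tmulA hS P Q (P.π a m) (Q.π b n)),
    P.isPartialRep.map_one, Q.isPartialRep.map_one]
  rfl

theorem tensorπ_pr2 (h k : H) :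
    sweedler 𝕜 k (fun a b => tensorπ hS P Q h * tensorπ hS P Q a *
      tensorπ hS P Q (antipode 𝕜 b)) =
    sweedler 𝕜 k (fun a b => tensorπ hS P Q (h * a) * tensorπ hS P Q (antipode 𝕜 b)) := by
  refine tensorA_ext hS P Q fun m n => ?_
  have hl : sweedler 𝕜 k (fun a b => tensorπ hS P Q h * tensorπ hS P Q a *
      tensorπ hS P Q (antipode 𝕜 b)) = tensorπ hS P Q h * epsL (tensorπ hS P Q) k := by
    rw [epsL_apply, lin_apply_sweedler (fun x => tensorπ hS P Q h * x)]
    simp only [mul_assoc]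
  rw [hl, Module.End.mul_apply, epsL_tensorπ, tensorπ_tmulA, sweedler_apply]
  refine Eq.symm ?_
  calc sweedler 𝕜 k (fun a b =>
        (tensorπ hS P Q (h * a) * tensorπ hS P Q (antipode 𝕜 b)) (tmulA hS P Q m n))
      = sweedler 𝕜 k (fun a b => sweedler 𝕜 b (fun c d => sweedler 𝕜 a (fun x y =>
          sweedler 𝕜 h (fun u v => tmulA hS P Q (P.π (u * x) (P.π (antipode 𝕜 d) m))
            (Q.π (v * y) (Q.π (antipode 𝕜 c) n)))))) := by
        refine sweedler_congr _ fun a b => ?_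
        rw [Module.End.mul_apply, tensorπ_tmulA,
          sweedler_antipode (fun c d => tmulA hS P Q (P.π c m) (Q.π d n)), map_sweedler]
        refine sweedler_congr _ fun c d => ?_
        rw [tensorπ_tmulA, sweedler_mul (fun x y =>
          tmulA hS P Q (P.π x (P.π (antipode 𝕜 d) m)) (Q.π y (Q.π (antipode 𝕜 c) n))),
          sweedler_comm]
    _ = sweedler 𝕜 k (fun a b => sweedler 𝕜 a (fun c d => sweedler 𝕜 d (fun x y =>
          sweedler 𝕜 h (fun u v => tmulA hS P Q (P.π (u * c) (P.π (antipode 𝕜 b) m))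
            (Q.π (v * x) (Q.π (antipode 𝕜 y) n)))))) :=
        sweedler_regroup (fun x y c d =>
          sweedler 𝕜 h (fun u v => tmulA hS P Q (P.π (u * x) (P.π (antipode 𝕜 d) m))
            (Q.π (v * y) (Q.π (antipode 𝕜 c) n)))) k
    _ = sweedler 𝕜 k (fun a b => sweedler 𝕜 h (fun u v =>
          tmulA hS P Q (P.π (u * a) (P.π (antipode 𝕜 b) m)) (Q.π v n))) := by
        refine sweedler_congr _ fun a b => ?_
        calc sweedler 𝕜 a (fun c d => sweedler 𝕜 d (fun x y =>
              sweedler 𝕜 h (fun u v => tmulA hS P Q (P.π (u * c) (P.π (antipode 𝕜 b) m))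
                (Q.π (v * x) (Q.π (antipode 𝕜 y) n)))))
            = sweedler 𝕜 a (fun c d => sweedler 𝕜 h (fun u v => sweedler 𝕜 v (fun x y =>
                tmulA hS P Q (P.π (u * c) (P.π (antipode 𝕜 b) m))
                  (epsL Q.π (x * d) (Q.π y n))))) := by
              refine sweedler_congr _ fun c d => ?_
              rw [sweedler_comm]
              refine sweedler_congr _ fun u v => ?_
              trans tmulA hS P Q (P.π (u * c) (P.π (antipode 𝕜 b) m))
                ((Q.π v * epsL Q.π d) n)
              · rw [Q.isPartialRep.mul_epsL, sweedler_apply, map_sweedler]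
                simp only [Module.End.mul_apply]
              · rw [← Q.isPartialRep.sweedler_epsL_mul_mul, sweedler_apply, map_sweedler]
                simp only [Module.End.mul_apply]
          _ = sweedler 𝕜 a (fun c d => sweedler 𝕜 h (fun u v => sweedler 𝕜 u (fun x y =>
                tmulA hS P Q (P.π (x * c) (P.π (antipode 𝕜 b) m))
                  (epsL Q.π (y * d) (Q.π v n))))) :=
              sweedler_congr _ fun c d => (sweedler_coassoc (fun u x y =>
                tmulA hS P Q (P.π (u * c) (P.π (antipode 𝕜 b) m))
                  (epsL Q.π (x * d) (Q.π y n))) h).symm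
          _ = sweedler 𝕜 h (fun u v => sweedler 𝕜 (u * a) (fun x y =>
                tmulA hS P Q (P.π x (P.π (antipode 𝕜 b) m)) (epsL Q.π y (Q.π v n)))) := by
              rw [sweedler_comm]
              refine sweedler_congr _ fun u v => ?_
              rw [sweedler_mul (fun x y => tmulA hS P Q (P.π x (P.π (antipode 𝕜 b) m))
                (epsL Q.π y (Q.π v n))), sweedler_comm]
          _ = _ := sweedler_congr _ fun u v => tmulA_sweedler_eps hS P Q _ _ _
    _ = sweedler 𝕜 h (fun u v => tmulA hS P Q (P.π u (epsL P.π k m)) (Q.π v n)) := by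
        rw [sweedler_comm]
        refine sweedler_congr _ fun u v => ?_
        rw [← Module.End.mul_apply (P.π u), P.isPartialRep.mul_epsL, sweedler_apply,
          lin_apply_sweedler (fun x => tmulA hS P Q x (Q.π v n))]
        simp only [Module.End.mul_apply]

theorem tensorπ_pr3 (h k : H) :
    sweedler 𝕜 h (fun a b => tensorπ hS P Q a * tensorπ hS P Q (antipode 𝕜 b) *
      tensorπ hS P Q k) =
    sweedler 𝕜 h (fun a b => tensorπ hS P Q a * tensorπ hS P Q (antipode 𝕜 b * k)) := by
  refine tensorA_ext hS P Q fun m n => ?_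
  have hl : sweedler 𝕜 h (fun a b => tensorπ hS P Q a * tensorπ hS P Q (antipode 𝕜 b) *
      tensorπ hS P Q k) = epsL (tensorπ hS P Q) h * tensorπ hS P Q k := by
    rw [epsL_apply, lin_apply_sweedler (fun x => x * tensorπ hS P Q k)]
  rw [hl, Module.End.mul_apply, tensorπ_tmulA, map_sweedler, sweedler_apply]
  refine Eq.symm ?_
  calc sweedler 𝕜 h (fun a b =>
        (tensorπ hS P Q a * tensorπ hS P Q (antipode 𝕜 b * k)) (tmulA hS P Q m n))
      = sweedler 𝕜 h (fun a b => sweedler 𝕜 b (fun c d => sweedler 𝕜 a (fun x y =>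
          sweedler 𝕜 k (fun u v => tmulA hS P Q (P.π x (P.π (antipode 𝕜 d * u) m))
            (Q.π y (Q.π (antipode 𝕜 c * v) n)))))) := by
        refine sweedler_congr _ fun a b => ?_
        rw [Module.End.mul_apply, tensorπ_tmulA,
          sweedler_mul (fun c d => tmulA hS P Q (P.π c m) (Q.π d n)),
          sweedler_antipode (fun c d => sweedler 𝕜 k (fun u v =>
            tmulA hS P Q (P.π (c * u) m) (Q.π (d * v) n))), map_sweedler]
        refine sweedler_congr _ fun c d => ?_
        rw [map_sweedler]
        simp only [tensorπ_tmulA]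
        rw [sweedler_comm]
    _ = sweedler 𝕜 h (fun a b => sweedler 𝕜 a (fun c d => sweedler 𝕜 d (fun x y =>
          sweedler 𝕜 k (fun u v => tmulA hS P Q (P.π c (P.π (antipode 𝕜 b * u) m))
            (Q.π x (Q.π (antipode 𝕜 y * v) n)))))) :=
        sweedler_regroup (fun x y c d =>
          sweedler 𝕜 k (fun u v => tmulA hS P Q (P.π x (P.π (antipode 𝕜 d * u) m))
            (Q.π y (Q.π (antipode 𝕜 c * v) n)))) h
    _ = sweedler 𝕜 h (fun a b => sweedler 𝕜 k (fun u v =>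
          tmulA hS P Q (P.π a (P.π (antipode 𝕜 b * u) m)) (Q.π v n))) := by
        refine sweedler_congr _ fun a b => ?_
        simp only [← tmulA_sweedler_eps hS P Q a]
        rw [sweedler_comm _ k a]
        refine sweedler_congr _ fun c d => ?_
        rw [sweedler_comm]
        refine sweedler_congr _ fun u v => ?_
        rw [← Module.End.mul_apply (epsL Q.π d), Q.isPartialRep.epsL_mul, sweedler_apply,
          map_sweedler]
        simp only [Module.End.mul_apply]
    _ = sweedler 𝕜 k (fun u v => epsL (tensorπ hS P Q) h (tmulA hS P Q (P.π u m) (Q.π v n))) := by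
        rw [sweedler_comm]
        refine sweedler_congr _ fun u v => ?_
        rw [epsL_tensorπ, ← Module.End.mul_apply (epsL P.π h), P.isPartialRep.epsL_mul,
          sweedler_apply, lin_apply_sweedler (fun x => tmulA hS P Q x (Q.π v n))]
        simp only [Module.End.mul_apply]

/-- The tensor product `M ⊗_A N` in the category of partial `H`-modules. -/
noncomputable def tensor : PartialModule 𝕜 H (TensorA hS P Q) where
  π := tensorπ hS P Q
  isPartialRep := ⟨tensorπ_one hS P Q, tensorπ_pr2 hS P Q, tensorπ_pr3 hS P Q⟩

variable {hS P Q R}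

theorem Hom.map_epsL (f : Hom P Q) (h : H) (m : M) :
    f.toLin (epsL P.π h m) = epsL Q.π h (f.toLin m) := by
  rw [epsL_apply, epsL_apply, sweedler_apply, sweedler_apply, map_sweedler]
  simp only [Module.End.mul_apply, f.map_act]

theorem Hom.map_epsR (f : Hom P Q) (h : H) (m : M) :
    f.toLin (epsR hS P.π h m) = epsR hS Q.π h (f.toLin m) := by
  rw [epsR_apply, epsR_apply, sweedler_apply, sweedler_apply, map_sweedler]
  simp only [Module.End.mul_apply, f.map_act]

variable (hS) in
/-- The linear map `m ⊗_A n ↦ f(m) ⊗_A g(n)`. -/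
noncomputable def mapLin {P' : PartialModule 𝕜 H M'} {Q' : PartialModule 𝕜 H N'}
    (f : Hom P P') (g : Hom Q Q') : TensorA hS P Q →ₗ[𝕜] TensorA hS P' Q' :=
  liftA hS P Q ((tmulA hS P' Q').compl₁₂ f.toLin g.toLin) (fun h m n => by
    simp only [LinearMap.compl₁₂_apply, f.map_epsR (hS := hS), g.map_epsL, tmulA_eps])

theorem mapLin_tmulA {P' : PartialModule 𝕜 H M'} {Q' : PartialModule 𝕜 H N'}
    (f : Hom P P') (g : Hom Q Q') (m : M) (n : N) :
    mapLin hS f g (tmulA hS P Q m n) = tmulA hS P' Q' (f.toLin m) (g.toLin n) := rfl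

variable (hS) in
/-- The tensor product `f ⊗_A g` of two morphisms. -/
noncomputable def Hom.tensor {P' : PartialModule 𝕜 H M'} {Q' : PartialModule 𝕜 H N'}
    (f : Hom P P') (g : Hom Q Q') : Hom (P.tensor hS Q) (P'.tensor hS Q') where
  toLin := mapLin hS f g
  map_act h x := by
    refine LinearMap.congr_fun (f := mapLin hS f g ∘ₗ tensorπ hS P Q h)
      (g := tensorπ hS P' Q' h ∘ₗ mapLin hS f g) (tensorA_ext hS P Q fun m n => ?_) x
    simp only [LinearMap.comp_apply, tensorπ_tmulA, map_sweedler, mapLin_tmulA, f.map_act,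
      g.map_act]

theorem Hom.tensor_tmulA {P' : PartialModule 𝕜 H M'} {Q' : PartialModule 𝕜 H N'}
    (f : Hom P P') (g : Hom Q Q') (m : M) (n : N) :
    (f.tensor hS g).toLin (tmulA hS P Q m n) = tmulA hS P' Q' (f.toLin m) (g.toLin n) := rfl

variable (hS P Q R)

/-- The associativity constraint `(L ⊗_A M) ⊗_A N → L ⊗_A (M ⊗_A N)`. -/
noncomputable def assocLin :
    TensorA hS (P.tensor hS Q) R →ₗ[𝕜] TensorA hS P (Q.tensor hS R) :=
  liftA hS (P.tensor hS Q) R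
    (liftA hS P Q
      (LinearMap.mk₂ 𝕜 (fun m n => tmulA hS P (Q.tensor hS R) m ∘ₗ tmulA hS Q R n)
        (fun m m' n => by ext; simp) (fun c m n => by ext; simp)
        (fun m n n' => by ext; simp) (fun c m n => by ext; simp))
      (fun h m n => by
        ext l
        simp only [LinearMap.mk₂_apply, LinearMap.comp_apply, tmulA_eps]
        rw [← epsL_tensorπ]; rfl))
    (fun h x l => by
      refine LinearMap.congr_fun (f := LinearMap.flip _ l ∘ₗ epsR hS (tensorπ hS P Q) h)
        (g := LinearMap.flip _ (epsL R.π h l)) (tensorA_ext hS P Q fun m n => ?_) x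
      simp only [LinearMap.comp_apply, LinearMap.flip_apply, epsR_tensorπ, liftA_tmulA,
        LinearMap.mk₂_apply, tmulA_eps])

theorem assocLin_tmulA (m : M) (n : N) (l : L) :
    assocLin hS P Q R (tmulA hS (P.tensor hS Q) R (tmulA hS P Q m n) l) =
      tmulA hS P (Q.tensor hS R) m (tmulA hS Q R n l) := rfl

/-- The associativity constraint as a morphism of partial `H`-modules. -/
noncomputable def associator :
    Hom ((P.tensor hS Q).tensor hS R) (P.tensor hS (Q.tensor hS R)) where
  toLin := assocLin hS P Q R
  map_act h x := by
    refine LinearMap.congr_fun (f := assocLin hS P Q R ∘ₗ tensorπ hS (P.tensor hS Q) R h)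
      (g := tensorπ hS P (Q.tensor hS R) h ∘ₗ assocLin hS P Q R)
      (tensorA_ext hS _ R fun y l => ?_) x
    refine LinearMap.congr_fun
      (f := (assocLin hS P Q R ∘ₗ tensorπ hS (P.tensor hS Q) R h) ∘ₗ
        (tmulA hS (P.tensor hS Q) R).flip l)
      (g := (tensorπ hS P (Q.tensor hS R) h ∘ₗ assocLin hS P Q R) ∘ₗ
        (tmulA hS (P.tensor hS Q) R).flip l)
      (tensorA_ext hS P Q fun m n => ?_) y
    simp only [LinearMap.comp_apply, LinearMap.flip_apply, assocLin_tmulA]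
    rw [tensorπ_tmulA, tensorπ_tmulA, map_sweedler]
    calc sweedler 𝕜 h (fun a b => assocLin hS P Q R (tmulA hS (P.tensor hS Q) R
          (tensorπ hS P Q a (tmulA hS P Q m n)) (R.π b l)))
        = sweedler 𝕜 h (fun a b => sweedler 𝕜 a (fun c d => tmulA hS P (Q.tensor hS R)
            (P.π c m) (tmulA hS Q R (Q.π d n) (R.π b l)))) := by
          refine sweedler_congr _ fun a b => ?_
          rw [tensorπ_tmulA, lin_apply_sweedler (fun x => assocLin hS P Q R
            (tmulA hS (P.tensor hS Q) R x (R.π b l)))]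
          simp only [assocLin_tmulA]
      _ = sweedler 𝕜 h (fun a b => sweedler 𝕜 b (fun c d => tmulA hS P (Q.tensor hS R)
            (P.π a m) (tmulA hS Q R (Q.π c n) (R.π d l)))) :=
          sweedler_coassoc (fun a c d => tmulA hS P (Q.tensor hS R)
            (P.π a m) (tmulA hS Q R (Q.π c n) (R.π d l))) h
      _ = sweedler 𝕜 h (fun a b => tmulA hS P (Q.tensor hS R) (P.π a m)
            (tensorπ hS Q R b (tmulA hS Q R n l))) := by
          refine sweedler_congr _ fun a b => ?_
          rw [tensorπ_tmulA, map_sweedler]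

end PartialModule

section

attribute [local irreducible] PartialModule.tensor

/-- A (not necessarily unital) algebra in the category of partial `H`-modules, with underlying
vector space `V`: a partial `H`-module structure on `V` together with a morphism of partial
`H`-modules `μ : V ⊗_A V → V` such that `μ (μ ⊗ id) = μ (id ⊗ μ) α`, where `α` is the
associativity constraint. -/
structure ParAlgebra (hS : Function.Bijective (antipode 𝕜 : H →ₗ[𝕜] H)) (V : Type*)
    [AddCommGroup V] [Module 𝕜 V] where
  toPartialModule : PartialModule 𝕜 H V
  μ : PartialModule.Hom (toPartialModule.tensor hS toPartialModule) toPartialModule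
  assoc : (PartialModule.Hom.tensor hS μ (PartialModule.Hom.id toPartialModule)).comp μ =
    (PartialModule.associator hS toPartialModule toPartialModule toPartialModule).comp
      ((PartialModule.Hom.tensor hS (PartialModule.Hom.id toPartialModule) μ).comp μ)

end

namespace ParAlgebra

variable {hS : Function.Bijective (antipode 𝕜 : H →ₗ[𝕜] H)} {V : Type*}
  [AddCommGroup V] [Module 𝕜 V]

/-- The action `h • v`. -/
noncomputable def act (X : ParAlgebra hS V) : H →ₗ[𝕜] V →ₗ[𝕜] V := X.toPartialModule.π

/-- The product `v w = μ(v ⊗_A w)`. -/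
noncomputable def mul (X : ParAlgebra hS V) : V →ₗ[𝕜] V →ₗ[𝕜] V :=
  (PartialModule.tmulA hS X.toPartialModule X.toPartialModule).compr₂ X.μ.toLin

end ParAlgebra

variable (𝕜 H) in
/-- A partial `H`-module algebra with symmetrical partial action, with underlying vector
space `V`: an associative product on `V` and a linear action of `H` with `1 · a = a`,
`h · (a (k · b)) = ∑ (h₁ · a) (h₂ k · b)` and `h · ((k · b) a) = ∑ (h₁ k · b) (h₂ · a)`. -/
structure SymmetricPartialModuleAlgebra (V : Type*) [AddCommGroup V] [Module 𝕜 V] where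
  mul : V →ₗ[𝕜] V →ₗ[𝕜] V
  mul_assoc : ∀ a b c : V, mul (mul a b) c = mul a (mul b c)
  act : H →ₗ[𝕜] V →ₗ[𝕜] V
  one_act : ∀ a : V, act 1 a = a
  act_mul_act : ∀ (h k : H) (a b : V), act h (mul a (act k b)) =
    sweedler 𝕜 h (fun h₁ h₂ => mul (act h₁ a) (act (h₂ * k) b))
  act_act_mul : ∀ (h k : H) (a b : V), act h (mul (act k b) a) =
    sweedler 𝕜 h (fun h₁ h₂ => mul (act (h₁ * k) b) (act h₂ a))

end Modules

section Admissible

variable {𝕜 V : Type*} [Field 𝕜] [AddCommGroup V] [Module 𝕜 V]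

/-- The algebra is idempotent: `A² = A`. -/
def IsIdempotentAlgebra (mul : V →ₗ[𝕜] V →ₗ[𝕜] V) : Prop :=
  Submodule.span 𝕜 {x | ∃ a b : V, x = mul a b} = ⊤

/-- The left annihilator `{b | ∀ a, b a = 0}` is zero. -/
def HasTrivialLeftAnnihilator (mul : V →ₗ[𝕜] V →ₗ[𝕜] V) : Prop :=
  ∀ b : V, (∀ a : V, mul b a = 0) → b = 0

/-- The right annihilator `{a | ∀ b, b a = 0}` is zero. -/
def HasTrivialRightAnnihilator (mul : V →ₗ[𝕜] V →ₗ[𝕜] V) : Prop :=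
  ∀ a : V, (∀ b : V, mul b a = 0) → a = 0

/-- The algebra is idempotent or has trivial left or right annihilator. -/
def IsAdmissible (mul : V →ₗ[𝕜] V →ₗ[𝕜] V) : Prop :=
  IsIdempotentAlgebra mul ∨ HasTrivialLeftAnnihilator mul ∨ HasTrivialRightAnnihilator mul

end Admissible

end PartialHopf

/-!
Both structures on `V` consist of a product and an action of `H`, so everything reduces to comparing
axioms.

From an algebra in the category of partial `H`-modules: since `μ` is a morphism,
`h · (x y) = ∑ (h₁ · x) (h₂ · y)`. The two axioms of a symmetric partial action follow from the
identities `∑ h₁ • m ⊗_A h₂ • (k • n) = ∑ h₁ • m ⊗_A h₂ k • n` and its mirror image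
(`PartialModule.sweedler_tmulA_act_act_right`, `PartialModule.sweedler_tmulA_act_act_left`). The
first holds because `h • m ⊗_A n = ∑ h₁ • m ⊗_A ε_{h₂} n` and `∑ ε_{h₁} [h₂ k] = [h] [k]`.

Conversely, the axioms of a symmetric partial action allow an action on one factor to be pulled out
of a product: `(h · x) y = ∑ h₁ · (x (S(h₂) · y))` and `x (h · y) = ∑ h₂ · ((S⁻¹(h₁) · x) y)`. With
these, the product is seen to be `A`-balanced (`SymmetricPartialModuleAlgebra.mul_balanced`), and
each of the two relations of a partial representation holds in three weak forms: evaluated at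
products, after multiplication from the right, and after multiplication from the left. An idempotent
algebra, one with trivial left annihilator, and one with trivial right annihilator each need exactly
one of these forms to conclude that the relation itself holds (`IsAdmissible.linearMap_ext`,
`SymmetricPartialModuleAlgebra.isPartialRep`).

The constructions keep product and action, which determine either structure, so they are mutually
inverse.
-/

namespace PartialHopf

/-! ### The inverse antipode -/

section Sweedler

variable {𝕜 H W : Type*} [Field 𝕜] [Ring H] [HopfAlgebra 𝕜 H] [AddCommGroup W] [Module 𝕜 W]

theorem sweedler_antipodeInv_right (hS : Function.Bijective (antipode 𝕜 : H →ₗ[𝕜] H))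
    (f : H → W) (h : H) (hf : ByLin (IsLinearMap 𝕜 f) := by exact {}) :
    sweedler 𝕜 h (fun a b => f (b * antipodeInv hS a)) = counit (R := 𝕜) h • f 1 := by
  have := sweedler_antipode_left (𝕜 := 𝕜) f (antipodeInv hS h) hf
  rw [sweedler_antipodeInv hS (fun a b => f (antipode 𝕜 a * b)) h
    ⟨fun b => lin_comp hf.out (lin_mul_left (lin_map _ lin_id) _),
      fun a => lin_comp hf.out (lin_mul_right _ lin_id)⟩] at this
  simp only [antipode_antipodeInv] at this
  rw [this, ← counit_antipode (R := 𝕜) (antipodeInv hS h), antipode_antipodeInv]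

end Sweedler

/-! ### Partial representations and the elements `ε_h` -/

namespace IsPartialRep

variable {𝕜 H B : Type*} [Field 𝕜] [Ring H] [HopfAlgebra 𝕜 H] [Ring B] [Algebra 𝕜 B]
  {π : H →ₗ[𝕜] B}

/-- `∑ ε_{h₁} π(h₂ k) = π(h) π(k)`: the factor `ε_{h₁}` absorbs the failure of `π` to be
multiplicative. -/
theorem sweedler_epsL_mul_map_mul (hπ : IsPartialRep π) (h k : H) :
    sweedler 𝕜 h (fun a b => epsL π a * π (b * k)) = π h * π k :=
  calc sweedler 𝕜 h (fun a b => epsL π a * π (b * k))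
      = sweedler 𝕜 h (fun a b => sweedler 𝕜 a (fun c d => π c * π (antipode 𝕜 d * b * k))) := by
        simp only [hπ.epsL_mul, mul_assoc]
    _ = sweedler 𝕜 h (fun a b => sweedler 𝕜 b (fun c d => π a * π (antipode 𝕜 c * d * k))) :=
        sweedler_coassoc (fun a c d => π a * π (antipode 𝕜 c * d * k)) h
    _ = sweedler 𝕜 h (fun a b => counit (R := 𝕜) b • (π a * π (1 * k))) :=
        sweedler_congr _ fun a b => sweedler_antipode_left (fun x => π a * π (x * k)) b
    _ = π h * π k := by
        rw [sweedler_counit_right (fun a => π a * π (1 * k)), one_mul]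

/-- The mirror image of `sweedler_epsL_mul_map_mul`, for the right action of `ε_h`. -/
theorem sweedler_epsR_mul_map_mul (hS : Function.Bijective (antipode 𝕜 : H →ₗ[𝕜] H))
    (hπ : IsPartialRep π) (h k : H) :
    sweedler 𝕜 h (fun a b => epsR hS π b * π (a * k)) = π h * π k :=
  calc sweedler 𝕜 h (fun a b => epsR hS π b * π (a * k))
      = sweedler 𝕜 h (fun a b => sweedler 𝕜 b (fun c d =>
          π d * π (antipodeInv hS c * a * k))) := by
        simp only [hπ.epsR_mul hS, mul_assoc]
    _ = sweedler 𝕜 h (fun a b => sweedler 𝕜 a (fun c d =>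
          π b * π (antipodeInv hS d * c * k))) :=
        (sweedler_coassoc (fun a c d => π d * π (antipodeInv hS c * a * k)) h).symm
    _ = sweedler 𝕜 h (fun a b => counit (R := 𝕜) a • (π b * π (1 * k))) :=
        sweedler_congr _ fun a b =>
          sweedler_antipodeInv_left hS (fun x => π b * π (x * k)) a
    _ = π h * π k := by
        rw [sweedler_counit_left (fun b => π b * π (1 * k)), one_mul]

end IsPartialRep

/-! ### Tensor products of partial modules -/

namespace PartialModule

variable {𝕜 H L M N W : Type*} [Field 𝕜] [Ring H] [HopfAlgebra 𝕜 H] [AddCommGroup L]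
  [Module 𝕜 L] [AddCommGroup M] [Module 𝕜 M] [AddCommGroup N] [Module 𝕜 N] [AddCommGroup W]
  [Module 𝕜 W] (hS : Function.Bijective (antipode 𝕜 : H →ₗ[𝕜] H))
  (P : PartialModule 𝕜 H M) (Q : PartialModule 𝕜 H N) (R : PartialModule 𝕜 H L)

theorem Hom.ext {P : PartialModule 𝕜 H M} {Q : PartialModule 𝕜 H N} {f g : Hom P Q}
    (hfg : f.toLin = g.toLin) : f = g := by
  cases f; cases g; cases hfg; rfl

theorem tensorA_ext₃ {f g : TensorA hS (P.tensor hS Q) R →ₗ[𝕜] W}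
    (hfg : ∀ x y z, f (tmulA hS (P.tensor hS Q) R (tmulA hS P Q x y) z) =
      g (tmulA hS (P.tensor hS Q) R (tmulA hS P Q x y) z)) : f = g :=
  tensorA_ext hS (P.tensor hS Q) R fun w z => LinearMap.congr_fun
    (f := f ∘ₗ (tmulA hS (P.tensor hS Q) R).flip z)
    (g := g ∘ₗ (tmulA hS (P.tensor hS Q) R).flip z)
    (tensorA_ext hS P Q fun x y => hfg x y z) w

/-- Under the diagonal action, `h₂ • (k • n)` may be replaced by `h₂ k • n`: an `ε` split off from
`h₁ • m` and moved across `⊗_A` turns the second into the first. -/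
theorem sweedler_tmulA_act_act_right (h k : H) (m : M) (n : N) :
    sweedler 𝕜 h (fun a b => tmulA hS P Q (P.π a m) (Q.π b (Q.π k n))) =
      sweedler 𝕜 h (fun a b => tmulA hS P Q (P.π a m) (Q.π (b * k) n)) :=
  Eq.symm <|
  calc sweedler 𝕜 h (fun a b => tmulA hS P Q (P.π a m) (Q.π (b * k) n))
      = sweedler 𝕜 h (fun a b => sweedler 𝕜 a (fun c d =>
          tmulA hS P Q (P.π c m) (epsL Q.π d (Q.π (b * k) n)))) :=
        sweedler_congr _ fun a b => (tmulA_sweedler_eps hS P Q a m _).symm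
    _ = sweedler 𝕜 h (fun a b => sweedler 𝕜 b (fun c d =>
          tmulA hS P Q (P.π a m) (epsL Q.π c (Q.π (d * k) n)))) :=
        sweedler_coassoc (fun a c d =>
          tmulA hS P Q (P.π a m) (epsL Q.π c (Q.π (d * k) n))) h
    _ = _ := by
        refine sweedler_congr _ fun a b => ?_
        rw [← Module.End.mul_apply (Q.π b), ← Q.isPartialRep.sweedler_epsL_mul_map_mul,
          sweedler_apply, map_sweedler]
        simp only [Module.End.mul_apply]

/-- The mirror image of `sweedler_tmulA_act_act_right`: `h₁ • (k • m)` may be replaced by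
`h₁ k • m`. -/
theorem sweedler_tmulA_act_act_left (h k : H) (m : M) (n : N) :
    sweedler 𝕜 h (fun a b => tmulA hS P Q (P.π a (P.π k m)) (Q.π b n)) =
      sweedler 𝕜 h (fun a b => tmulA hS P Q (P.π (a * k) m) (Q.π b n)) :=
  Eq.symm <|
  calc sweedler 𝕜 h (fun a b => tmulA hS P Q (P.π (a * k) m) (Q.π b n))
      = sweedler 𝕜 h (fun a b => sweedler 𝕜 b (fun c d =>
          tmulA hS P Q (epsR hS P.π c (P.π (a * k) m)) (Q.π d n))) := by
        refine sweedler_congr _ fun a b => ?_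
        rw [← Q.isPartialRep.sweedler_epsL_mul b, sweedler_apply, map_sweedler]
        simp only [Module.End.mul_apply, tmulA_eps]
    _ = sweedler 𝕜 h (fun a b => sweedler 𝕜 a (fun c d =>
          tmulA hS P Q (epsR hS P.π d (P.π (c * k) m)) (Q.π b n))) :=
        (sweedler_coassoc (fun a c d =>
          tmulA hS P Q (epsR hS P.π c (P.π (a * k) m)) (Q.π d n)) h).symm
    _ = _ := by
        refine sweedler_congr _ fun a b => ?_
        rw [← Module.End.mul_apply (P.π a), ← P.isPartialRep.sweedler_epsR_mul_map_mul hS,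
          sweedler_apply, lin_apply_sweedler (fun x => tmulA hS P Q x (Q.π b n))]
        simp only [Module.End.mul_apply]

end PartialModule

/-! ### Identities in a symmetric partial module algebra -/

namespace SymmetricPartialModuleAlgebra

variable {𝕜 H V : Type*} [Field 𝕜] [Ring H] [HopfAlgebra 𝕜 H] [AddCommGroup V] [Module 𝕜 V]
  (Y : SymmetricPartialModuleAlgebra 𝕜 H V)

@[ext]
theorem ext {Y Z : SymmetricPartialModuleAlgebra 𝕜 H V} (hm : Y.mul = Z.mul)
    (ha : Y.act = Z.act) : Y = Z := by
  cases Y; cases Z; cases hm; cases ha; rfl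

theorem act_mul (h : H) (x y : V) :
    Y.act h (Y.mul x y) = sweedler 𝕜 h (fun a b => Y.mul (Y.act a x) (Y.act b y)) := by
  simpa only [Y.one_act, mul_one] using Y.act_mul_act h 1 x y

/-- The axiom `h · (x (k · y)) = ∑ (h₁ · x) (h₂ k · y)`, with the cancellation
`∑ k₁ S(k₂) = ε(k) 1` carried out. -/
theorem sweedler_act_mul_act_antipode (h k l : H) (x y : V) :
    sweedler 𝕜 k (fun a b => Y.act (h * a) (Y.mul x (Y.act (antipode 𝕜 b * l) y))) =
      sweedler 𝕜 h (fun u v => Y.mul (Y.act (u * k) x) (Y.act (v * l) y)) :=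
  calc sweedler 𝕜 k (fun a b => Y.act (h * a) (Y.mul x (Y.act (antipode 𝕜 b * l) y)))
      = sweedler 𝕜 k (fun a b => sweedler 𝕜 a (fun c d => sweedler 𝕜 h (fun u v =>
          Y.mul (Y.act (u * c) x) (Y.act (v * (d * antipode 𝕜 b * l)) y)))) := by
        refine sweedler_congr _ fun a b => ?_
        rw [Y.act_mul_act, sweedler_mul (fun u v =>
          Y.mul (Y.act u x) (Y.act (v * (antipode 𝕜 b * l)) y)), sweedler_comm]
        simp only [_root_.mul_assoc]
    _ = sweedler 𝕜 k (fun a b => sweedler 𝕜 b (fun c d => sweedler 𝕜 h (fun u v =>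
          Y.mul (Y.act (u * a) x) (Y.act (v * (c * antipode 𝕜 d * l)) y)))) :=
        sweedler_coassoc (fun a c d => sweedler 𝕜 h (fun u v =>
          Y.mul (Y.act (u * a) x) (Y.act (v * (c * antipode 𝕜 d * l)) y))) k
    _ = sweedler 𝕜 k (fun a b => counit (R := 𝕜) b • sweedler 𝕜 h (fun u v =>
          Y.mul (Y.act (u * a) x) (Y.act (v * (1 * l)) y))) :=
        sweedler_congr _ fun a b => sweedler_antipode_right (fun z => sweedler 𝕜 h (fun u v =>
          Y.mul (Y.act (u * a) x) (Y.act (v * (z * l)) y))) b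
    _ = _ := by
        rw [sweedler_counit_right (fun a => sweedler 𝕜 h (fun u v =>
          Y.mul (Y.act (u * a) x) (Y.act (v * (1 * l)) y)))]
        simp only [one_mul]

/-- `(h · x) (l · y) = ∑ h₁ · (x (S(h₂) l · y))`: an action on the left factor can be pulled out
of a product. -/
theorem act_mul_act_eq_sweedler (h l : H) (x y : V) :
    Y.mul (Y.act h x) (Y.act l y) =
      sweedler 𝕜 h (fun a b => Y.act a (Y.mul x (Y.act (antipode 𝕜 b * l) y))) := by
  have := Y.sweedler_act_mul_act_antipode 1 h l x y
  rw [sweedler_one (fun u v => Y.mul (Y.act (u * h) x) (Y.act (v * l) y))] at this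
  simpa only [one_mul] using this.symm

theorem act_mul_eq_sweedler (h : H) (x y : V) : Y.mul (Y.act h x) y =
    sweedler 𝕜 h (fun a b => Y.act a (Y.mul x (Y.act (antipode 𝕜 b) y))) := by
  simpa only [Y.one_act, mul_one] using Y.act_mul_act_eq_sweedler h 1 x y

/-- The right-hand side depends on `k` and `x` only through `k · x`. This gives the second relation
for partial representations after multiplication from the right. -/
theorem sweedler_act_act_antipode_mul (h k : H) (x y : V) :
    sweedler 𝕜 h (fun a b => Y.mul (Y.act a (Y.act (antipode 𝕜 b * k) x)) y) =
      sweedler 𝕜 h (fun a b => Y.act a (Y.act (antipode 𝕜 b) (Y.mul (Y.act k x) y))) :=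
  calc sweedler 𝕜 h (fun a b => Y.mul (Y.act a (Y.act (antipode 𝕜 b * k) x)) y)
      = sweedler 𝕜 h (fun a b => sweedler 𝕜 a (fun c d => Y.act c
          (Y.mul (Y.act (antipode 𝕜 b * k) x) (Y.act (antipode 𝕜 d) y)))) :=
        sweedler_congr _ fun a b => Y.act_mul_eq_sweedler a _ y
    _ = sweedler 𝕜 h (fun a b => sweedler 𝕜 b (fun c d => Y.act a
          (Y.mul (Y.act (antipode 𝕜 d * k) x) (Y.act (antipode 𝕜 c) y)))) :=
        sweedler_coassoc (fun a c d => Y.act a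
          (Y.mul (Y.act (antipode 𝕜 d * k) x) (Y.act (antipode 𝕜 c) y))) h
    _ = _ := by
        refine sweedler_congr _ fun a b => ?_
        rw [Y.act_act_mul, sweedler_antipode (fun c d =>
          Y.mul (Y.act (c * k) x) (Y.act d y)), map_sweedler]

/-- The right-hand side is `h · ((ε_k x) y)`. The case `h = 1` says that `ε_k (x y) = (ε_k x) y`,
so this is the first relation for partial representations, evaluated at products. -/
theorem sweedler_act_mul_act_act_antipode (h k : H) (x y : V) :
    sweedler 𝕜 k (fun a b => Y.act (h * a) (Y.act (antipode 𝕜 b) (Y.mul x y))) =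
      sweedler 𝕜 k (fun a b => Y.act h (Y.mul (Y.act a (Y.act (antipode 𝕜 b) x)) y)) :=
  calc sweedler 𝕜 k (fun a b => Y.act (h * a) (Y.act (antipode 𝕜 b) (Y.mul x y)))
      = sweedler 𝕜 k (fun a b => sweedler 𝕜 b (fun c d => Y.act (h * a)
          (Y.mul (Y.act (antipode 𝕜 d) x) (Y.act (antipode 𝕜 c * 1) y)))) := by
        refine sweedler_congr _ fun a b => ?_
        rw [Y.act_mul, sweedler_antipode (fun c d => Y.mul (Y.act c x) (Y.act d y)),
          map_sweedler]
        simp only [mul_one]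
    _ = sweedler 𝕜 k (fun a b => sweedler 𝕜 a (fun c d => Y.act (h * c)
          (Y.mul (Y.act (antipode 𝕜 b) x) (Y.act (antipode 𝕜 d * 1) y)))) :=
        (sweedler_coassoc (fun a c d => Y.act (h * a)
          (Y.mul (Y.act (antipode 𝕜 d) x) (Y.act (antipode 𝕜 c * 1) y))) k).symm
    _ = _ := by
        refine sweedler_congr _ fun a b => ?_
        rw [Y.sweedler_act_mul_act_antipode, Y.act_act_mul]
        simp only [mul_one]

/-- The first relation for partial representations holds after multiplication from the right by
`y`. -/
theorem sweedler_mul_pr2 (h k : H) (x y : V) :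
    sweedler 𝕜 k (fun a b => Y.mul (Y.act h (Y.act a (Y.act (antipode 𝕜 b) x))) y) =
      sweedler 𝕜 k (fun a b => Y.mul (Y.act (h * a) (Y.act (antipode 𝕜 b) x)) y) :=
  calc sweedler 𝕜 k (fun a b => Y.mul (Y.act h (Y.act a (Y.act (antipode 𝕜 b) x))) y)
      = sweedler 𝕜 h (fun u v => sweedler 𝕜 k (fun a b => Y.act u
          (Y.mul (Y.act a (Y.act (antipode 𝕜 b) x)) (Y.act (antipode 𝕜 v) y)))) := by
        rw [sweedler_comm]
        exact sweedler_congr _ fun a b => Y.act_mul_eq_sweedler h _ y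
    _ = sweedler 𝕜 h (fun u v => sweedler 𝕜 k (fun a b => sweedler 𝕜 b (fun c d =>
          Y.act (u * a) (Y.mul (Y.act (antipode 𝕜 d) x)
            (Y.act (antipode 𝕜 c * antipode 𝕜 v) y))))) := by
        refine sweedler_congr _ fun u v => ?_
        rw [← Y.sweedler_act_mul_act_act_antipode]
        refine sweedler_congr _ fun a b => ?_
        rw [Y.act_mul_act, sweedler_antipode (fun c d =>
          Y.mul (Y.act c x) (Y.act (d * antipode 𝕜 v) y)), map_sweedler]
    _ = sweedler 𝕜 h (fun u v => sweedler 𝕜 k (fun a b => sweedler 𝕜 a (fun c d =>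
          Y.act (u * c) (Y.mul (Y.act (antipode 𝕜 b) x)
            (Y.act (antipode 𝕜 d * antipode 𝕜 v) y))))) :=
        sweedler_congr _ fun u v => (sweedler_coassoc (fun a c d =>
          Y.act (u * a) (Y.mul (Y.act (antipode 𝕜 d) x)
            (Y.act (antipode 𝕜 c * antipode 𝕜 v) y))) k).symm
    _ = _ := by
        rw [sweedler_comm]
        refine sweedler_congr _ fun a b => ?_
        rw [Y.act_mul_eq_sweedler, sweedler_mul (fun u v =>
          Y.act u (Y.mul (Y.act (antipode 𝕜 b) x) (Y.act (antipode 𝕜 v) y)))]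
        simp only [antipode_mul_antidistrib]

/-- The second relation for partial representations holds at products. -/
theorem sweedler_pr3_mul (h k : H) (x y : V) :
    sweedler 𝕜 h (fun a b => Y.act a (Y.act (antipode 𝕜 b) (Y.act k (Y.mul x y)))) =
      sweedler 𝕜 h (fun a b => Y.act a (Y.act (antipode 𝕜 b * k) (Y.mul x y))) :=
  Eq.symm <|
  calc sweedler 𝕜 h (fun a b => Y.act a (Y.act (antipode 𝕜 b * k) (Y.mul x y)))
      = sweedler 𝕜 k (fun u v => sweedler 𝕜 h (fun a b => sweedler 𝕜 b (fun c d => Y.act a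
          (Y.mul (Y.act (antipode 𝕜 d * u) x) (Y.act (antipode 𝕜 c * v) y))))) := by
        rw [sweedler_comm]
        refine sweedler_congr _ fun a b => ?_
        rw [Y.act_mul, sweedler_mul (fun c d => Y.mul (Y.act c x) (Y.act d y)),
          sweedler_antipode (fun c d => sweedler 𝕜 k (fun u v =>
            Y.mul (Y.act (c * u) x) (Y.act (d * v) y))), map_sweedler, sweedler_comm]
        simp only [map_sweedler]
    _ = sweedler 𝕜 k (fun u v => sweedler 𝕜 h (fun a b => sweedler 𝕜 a (fun c d => Y.act c
          (Y.mul (Y.act (antipode 𝕜 b * u) x) (Y.act (antipode 𝕜 d * v) y))))) :=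
        sweedler_congr _ fun u v => (sweedler_coassoc (fun a c d => Y.act a
          (Y.mul (Y.act (antipode 𝕜 d * u) x) (Y.act (antipode 𝕜 c * v) y))) h).symm
    _ = sweedler 𝕜 k (fun u v => sweedler 𝕜 h (fun a b => Y.act a (Y.act (antipode 𝕜 b)
          (Y.mul (Y.act u x) (Y.act v y))))) := by
        refine sweedler_congr _ fun u v => ?_
        rw [← Y.sweedler_act_act_antipode_mul]
        exact sweedler_congr _ fun a b => (Y.act_mul_act_eq_sweedler a v _ y).symm
    _ = _ := by
        rw [sweedler_comm]
        refine sweedler_congr _ fun a b => ?_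
        rw [Y.act_mul, map_sweedler, map_sweedler]

variable (hS : Function.Bijective (antipode 𝕜 : H →ₗ[𝕜] H))

/-- `(l · x) (h · y) = ∑ h₂ · ((S⁻¹(h₁) l · x) y)`: an action on the right factor can be pulled
out of a product. -/
theorem act_mul_act_eq_sweedler_antipodeInv (h l : H) (x y : V) :
    Y.mul (Y.act l x) (Y.act h y) =
    sweedler 𝕜 h (fun a b => Y.act b (Y.mul (Y.act (antipodeInv hS a * l) x) y)) :=
  Eq.symm <|
  calc sweedler 𝕜 h (fun a b => Y.act b (Y.mul (Y.act (antipodeInv hS a * l) x) y))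
      = sweedler 𝕜 h (fun a b => sweedler 𝕜 b (fun c d =>
          Y.mul (Y.act (c * antipodeInv hS a * l) x) (Y.act d y))) := by
        simp only [Y.act_act_mul, _root_.mul_assoc]
    _ = sweedler 𝕜 h (fun a b => sweedler 𝕜 a (fun c d =>
          Y.mul (Y.act (d * antipodeInv hS c * l) x) (Y.act b y))) :=
        (sweedler_coassoc (fun a c d =>
          Y.mul (Y.act (c * antipodeInv hS a * l) x) (Y.act d y)) h).symm
    _ = sweedler 𝕜 h (fun a b => counit (R := 𝕜) a • Y.mul (Y.act (1 * l) x) (Y.act b y)) :=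
        sweedler_congr _ fun a b => sweedler_antipodeInv_right hS (fun z =>
          Y.mul (Y.act (z * l) x) (Y.act b y)) a
    _ = _ := by
        rw [sweedler_counit_left (fun b => Y.mul (Y.act (1 * l) x) (Y.act b y)), one_mul]

theorem mul_act_eq_sweedler (h : H) (x y : V) : Y.mul x (Y.act h y) =
    sweedler 𝕜 h (fun a b => Y.act b (Y.mul (Y.act (antipodeInv hS a) x) y)) := by
  simpa only [Y.one_act, mul_one] using Y.act_mul_act_eq_sweedler_antipodeInv hS h 1 x y

/-- For `l = 1` this is the balancedness of the product over `A`. The right-hand side depends on `l`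
and `x` only through `l · x`, so on the left `S⁻¹(k₁) l · x` may be replaced by
`S⁻¹(k₁) · (l · x)`. -/
theorem sweedler_act_act_antipodeInv_mul (k l : H) (x y : V) :
    sweedler 𝕜 k (fun a b => Y.mul (Y.act b (Y.act (antipodeInv hS a * l) x)) y) =
      sweedler 𝕜 k (fun a b => Y.mul (Y.act l x) (Y.act a (Y.act (antipode 𝕜 b) y))) :=
  calc sweedler 𝕜 k (fun a b => Y.mul (Y.act b (Y.act (antipodeInv hS a * l) x)) y)
      = sweedler 𝕜 k (fun a b => sweedler 𝕜 b (fun c d => Y.act c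
          (Y.mul (Y.act (antipodeInv hS a * l) x) (Y.act (antipode 𝕜 d) y)))) :=
        sweedler_congr _ fun a b => Y.act_mul_eq_sweedler b _ y
    _ = sweedler 𝕜 k (fun a b => sweedler 𝕜 a (fun c d => Y.act d
          (Y.mul (Y.act (antipodeInv hS c * l) x) (Y.act (antipode 𝕜 b) y)))) :=
        (sweedler_coassoc (fun a c d => Y.act c
          (Y.mul (Y.act (antipodeInv hS a * l) x) (Y.act (antipode 𝕜 d) y))) k).symm
    _ = _ :=
        sweedler_congr _ fun a b => (Y.act_mul_act_eq_sweedler_antipodeInv hS a l x _).symm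

/-- The right-hand side depends on `l` and `y` only through `l · y`, so on the left `S(h₂) l · y` may
be replaced by `S(h₂) · (l · y)`. -/
theorem sweedler_mul_act_act_antipode (h l : H) (x y : V) :
    sweedler 𝕜 h (fun a b => Y.mul x (Y.act a (Y.act (antipode 𝕜 b * l) y))) =
      sweedler 𝕜 h (fun a b => Y.mul (Y.act b (Y.act (antipodeInv hS a) x)) (Y.act l y)) :=
  calc sweedler 𝕜 h (fun a b => Y.mul x (Y.act a (Y.act (antipode 𝕜 b * l) y)))
      = sweedler 𝕜 h (fun a b => sweedler 𝕜 a (fun c d => Y.act d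
          (Y.mul (Y.act (antipodeInv hS c) x) (Y.act (antipode 𝕜 b * l) y)))) :=
        sweedler_congr _ fun a b => Y.mul_act_eq_sweedler hS a x _
    _ = sweedler 𝕜 h (fun a b => sweedler 𝕜 b (fun c d => Y.act c
          (Y.mul (Y.act (antipodeInv hS a) x) (Y.act (antipode 𝕜 d * l) y)))) :=
        sweedler_coassoc (fun a c d => Y.act c
          (Y.mul (Y.act (antipodeInv hS a) x) (Y.act (antipode 𝕜 d * l) y))) h
    _ = _ := sweedler_congr _ fun a b => (Y.act_mul_act_eq_sweedler b l _ y).symm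

/-- The product is balanced over `A`, hence factors through `V ⊗_A V`. -/
theorem mul_balanced (h : H) (x y : V) :
    Y.mul (epsR hS Y.act h x) y = Y.mul x (epsL (B := Module.End 𝕜 V) Y.act h y) := by
  rw [epsR_apply, sweedler_apply _ _ x, lin_apply_sweedler (fun z => Y.mul z y), epsL_apply,
    sweedler_apply _ _ y, map_sweedler]
  simpa only [mul_one, Y.one_act, Module.End.mul_apply] using
    Y.sweedler_act_act_antipodeInv_mul hS h 1 x y

/-- The second relation for partial representations holds after multiplication from the left by
`x`. -/
theorem sweedler_mul_right_pr3 (hS : Function.Bijective (antipode 𝕜 : H →ₗ[𝕜] H)) (h k : H)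
    (x y : V) :
    sweedler 𝕜 h (fun a b => Y.mul x (Y.act a (Y.act (antipode 𝕜 b) (Y.act k y)))) =
      sweedler 𝕜 h (fun a b => Y.mul x (Y.act a (Y.act (antipode 𝕜 b * k) y))) := by
  rw [Y.sweedler_mul_act_act_antipode hS]
  simpa only [mul_one, Y.one_act] using Y.sweedler_mul_act_act_antipode hS h 1 x (Y.act k y)

/-- The first relation for partial representations holds after multiplication from the left by
`x`. -/
theorem sweedler_mul_right_pr2 (hS : Function.Bijective (antipode 𝕜 : H →ₗ[𝕜] H)) (h k : H)
    (x y : V) :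
    sweedler 𝕜 k (fun a b => Y.mul x (Y.act h (Y.act a (Y.act (antipode 𝕜 b) y)))) =
      sweedler 𝕜 k (fun a b => Y.mul x (Y.act (h * a) (Y.act (antipode 𝕜 b) y))) :=
  Eq.symm <|
  calc sweedler 𝕜 k (fun a b => Y.mul x (Y.act (h * a) (Y.act (antipode 𝕜 b) y)))
      = sweedler 𝕜 h (fun u v => sweedler 𝕜 k (fun a b => sweedler 𝕜 a (fun c d =>
          Y.act (v * d) (Y.mul (Y.act (antipodeInv hS c * antipodeInv hS u) x)
            (Y.act (antipode 𝕜 b * 1) y))))) := by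
        rw [sweedler_comm]
        refine sweedler_congr _ fun a b => ?_
        rw [Y.mul_act_eq_sweedler hS, sweedler_mul (fun u v =>
          Y.act v (Y.mul (Y.act (antipodeInv hS u) x) (Y.act (antipode 𝕜 b) y)))]
        simp only [antipodeInv_mul, mul_one]
    _ = sweedler 𝕜 h (fun u v => sweedler 𝕜 k (fun a b => sweedler 𝕜 b (fun c d =>
          Y.act (v * c) (Y.mul (Y.act (antipodeInv hS a * antipodeInv hS u) x)
            (Y.act (antipode 𝕜 d * 1) y))))) :=
        sweedler_congr _ fun u v => sweedler_coassoc (fun a c d =>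
          Y.act (v * c) (Y.mul (Y.act (antipodeInv hS a * antipodeInv hS u) x)
            (Y.act (antipode 𝕜 d * 1) y))) k
    _ = sweedler 𝕜 h (fun u v => Y.act v (sweedler 𝕜 k (fun a b =>
          Y.mul (Y.act b (Y.act (antipodeInv hS a * antipodeInv hS u) x)) y))) := by
        refine sweedler_congr _ fun u v => ?_
        rw [map_sweedler]
        refine sweedler_congr _ fun a b => ?_
        rw [Y.sweedler_act_mul_act_antipode, Y.act_act_mul]
        simp only [mul_one]
    _ = _ := by
        simp only [Y.sweedler_act_act_antipodeInv_mul hS, map_sweedler]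
        rw [sweedler_comm]
        exact sweedler_congr _ fun a b => (Y.mul_act_eq_sweedler hS h x _).symm

end SymmetricPartialModuleAlgebra

/-! ### From symmetric partial actions to algebras in the category -/

/-- Linear endomorphisms of an admissible algebra agree if they agree on products and after
multiplication from either side. Each form of admissibility uses one of the hypotheses. -/
theorem IsAdmissible.linearMap_ext {𝕜 V : Type*} [Field 𝕜] [AddCommGroup V] [Module 𝕜 V]
    {mul : V →ₗ[𝕜] V →ₗ[𝕜] V} (hm : IsAdmissible mul) {F G : V →ₗ[𝕜] V}
    (hp : ∀ x y, F (mul x y) = G (mul x y)) (hl : ∀ x y, mul (F x) y = mul (G x) y)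
    (hr : ∀ x y, mul x (F y) = mul x (G y)) : F = G := by
  rcases hm with hm | hm | hm
  · refine LinearMap.ext_on hm ?_
    rintro _ ⟨x, y, rfl⟩
    exact hp x y
  · ext x
    refine sub_eq_zero.1 (hm _ fun y => ?_)
    rw [map_sub, LinearMap.sub_apply, hl, sub_self]
  · ext y
    refine sub_eq_zero.1 (hm _ fun x => ?_)
    rw [map_sub, hr, sub_self]

namespace SymmetricPartialModuleAlgebra

variable {𝕜 H V : Type*} [Field 𝕜] [Ring H] [HopfAlgebra 𝕜 H] [AddCommGroup V] [Module 𝕜 V]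
  (Y : SymmetricPartialModuleAlgebra 𝕜 H V)

theorem isPartialRep (hS : Function.Bijective (antipode 𝕜 : H →ₗ[𝕜] H))
    (hm : IsAdmissible Y.mul) : IsPartialRep (B := Module.End 𝕜 V) Y.act where
  map_one := LinearMap.ext Y.one_act
  pr2 h k := by
    refine hm.linearMap_ext (fun x y => ?_) (fun x y => ?_) (fun x y => ?_) <;>
      simp only [sweedler_apply, Module.End.mul_apply]
    · rw [Y.sweedler_act_mul_act_act_antipode]
      simpa only [one_mul, Y.one_act, map_sweedler] using
        congrArg (Y.act h) (Y.sweedler_act_mul_act_act_antipode 1 k x y)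
    · rw [lin_apply_sweedler (fun z => Y.mul z y), lin_apply_sweedler (fun z => Y.mul z y)]
      exact Y.sweedler_mul_pr2 h k x y
    · rw [map_sweedler, map_sweedler]
      exact Y.sweedler_mul_right_pr2 hS h k x y
  pr3 h k := by
    refine hm.linearMap_ext (fun x y => ?_) (fun x y => ?_) (fun x y => ?_) <;>
      simp only [sweedler_apply, Module.End.mul_apply]
    · exact Y.sweedler_pr3_mul h k x y
    · rw [lin_apply_sweedler (fun z => Y.mul z y), lin_apply_sweedler (fun z => Y.mul z y),
        Y.sweedler_act_act_antipode_mul]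
      simpa only [mul_one, Y.one_act] using Y.sweedler_act_act_antipode_mul h 1 (Y.act k x) y
    · rw [map_sweedler, map_sweedler]
      exact Y.sweedler_mul_right_pr3 hS h k x y

/-- The partial `H`-module underlying a symmetric partial `H`-module algebra whose product is
admissible. -/
def toPartialModule (hS : Function.Bijective (antipode 𝕜 : H →ₗ[𝕜] H))
    (hm : IsAdmissible Y.mul) : PartialModule 𝕜 H V :=
  ⟨Y.act, Y.isPartialRep hS hm⟩

/-- The multiplication `V ⊗_A V → V` induced by the product of a symmetric partial `H`-module
algebra, as a morphism of partial `H`-modules. -/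
noncomputable def mulHom (hS : Function.Bijective (antipode 𝕜 : H →ₗ[𝕜] H))
    (hm : IsAdmissible Y.mul) : PartialModule.Hom
      ((Y.toPartialModule hS hm).tensor hS (Y.toPartialModule hS hm))
      (Y.toPartialModule hS hm) where
  toLin := PartialModule.liftA hS (Y.toPartialModule hS hm) (Y.toPartialModule hS hm) Y.mul
    (Y.mul_balanced hS)
  map_act h z := by
    refine LinearMap.congr_fun
      (f := PartialModule.liftA hS (Y.toPartialModule hS hm) (Y.toPartialModule hS hm) Y.mul
        (Y.mul_balanced hS) ∘ₗ PartialModule.tensorπ hS _ _ h)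
      (g := Y.act h ∘ₗ PartialModule.liftA hS (Y.toPartialModule hS hm)
        (Y.toPartialModule hS hm) Y.mul (Y.mul_balanced hS))
      (PartialModule.tensorA_ext hS _ _ fun x y => ?_) z
    rw [LinearMap.comp_apply, PartialModule.tensorπ_tmulA, map_sweedler]
    exact (Y.act_mul h x y).symm

/-- The algebra in the category of partial `H`-modules given by a symmetric partial `H`-module
algebra whose product is admissible. -/
noncomputable def toParAlgebra (hS : Function.Bijective (antipode 𝕜 : H →ₗ[𝕜] H))
    (hm : IsAdmissible Y.mul) : ParAlgebra hS V where
  toPartialModule := Y.toPartialModule hS hm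
  μ := Y.mulHom hS hm
  assoc :=
    PartialModule.Hom.ext (PartialModule.tensorA_ext₃ hS _ _ _ Y.mul_assoc)

end SymmetricPartialModuleAlgebra

/-! ### From algebras in the category to symmetric partial actions -/

namespace ParAlgebra

variable {𝕜 H V : Type*} [Field 𝕜] [Ring H] [HopfAlgebra 𝕜 H] [AddCommGroup V] [Module 𝕜 V]
  {hS : Function.Bijective (antipode 𝕜 : H →ₗ[𝕜] H)}

/-- The multiplication `μ` is determined by the product, since the elements `x ⊗_A y` span
`V ⊗_A V`. -/
theorem ext_of_mul_act {X X' : ParAlgebra hS V} (hm : X.mul = X'.mul) (ha : X.act = X'.act) :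
    X = X' := by
  obtain ⟨⟨π, hπ⟩, ⟨μ, hμ⟩, hX⟩ := X
  obtain ⟨⟨π', hπ'⟩, ⟨μ', hμ'⟩, hX'⟩ := X'
  obtain rfl : π = π' := ha
  obtain rfl : μ = μ' := PartialModule.tensorA_ext hS _ _ fun x y =>
    LinearMap.congr_fun (LinearMap.congr_fun hm x) y
  rfl

theorem act_mul (X : ParAlgebra hS V) (h : H) (x y : V) :
    X.act h (X.mul x y) = sweedler 𝕜 h (fun a b => X.mul (X.act a x) (X.act b y)) := by
  refine (X.μ.map_act h (PartialModule.tmulA hS _ _ x y)).symm.trans ?_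
  refine (congrArg X.μ.toLin (PartialModule.tensorπ_tmulA hS _ _ h x y)).trans ?_
  exact map_sweedler _ _ _

/-- The symmetric partial `H`-module algebra underlying an algebra in the category of partial
`H`-modules. -/
noncomputable def toSymmetric (X : ParAlgebra hS V) : SymmetricPartialModuleAlgebra 𝕜 H V where
  mul := X.mul
  mul_assoc x y z := LinearMap.congr_fun (congrArg PartialModule.Hom.toLin X.assoc)
    (PartialModule.tmulA hS _ _ (PartialModule.tmulA hS _ _ x y) z)
  act := X.act
  one_act x := LinearMap.congr_fun X.toPartialModule.isPartialRep.map_one x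
  act_mul_act h k x y := by
    have := congrArg X.μ.toLin (PartialModule.sweedler_tmulA_act_act_right hS
      X.toPartialModule X.toPartialModule h k x y)
    rw [map_sweedler, map_sweedler] at this
    exact (X.act_mul h x (X.act k y)).trans this
  act_act_mul h k x y := by
    have := congrArg X.μ.toLin (PartialModule.sweedler_tmulA_act_act_left hS
      X.toPartialModule X.toPartialModule h k y x)
    rw [map_sweedler, map_sweedler] at this
    exact (X.act_mul h (X.act k y) x).trans this

end ParAlgebra

end PartialHopf

theorem mainTheorem1 {𝕜 H V : Type*} [Field 𝕜] [Ring H] [HopfAlgebra 𝕜 H]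
    [AddCommGroup V] [Module 𝕜 V]
    (hS : Function.Bijective (HopfAlgebra.antipode 𝕜 : H →ₗ[𝕜] H)) :
    ∃ e : {X : PartialHopf.ParAlgebra hS V // PartialHopf.IsAdmissible X.mul} ≃
        {Y : PartialHopf.SymmetricPartialModuleAlgebra 𝕜 H V // PartialHopf.IsAdmissible Y.mul},
      ∀ X, (e X).1.mul = X.1.mul ∧ (e X).1.act = X.1.act :=
  ⟨{ toFun := fun X => ⟨X.1.toSymmetric, X.2⟩
     invFun := fun Y => ⟨Y.1.toParAlgebra hS Y.2, Y.2⟩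
     left_inv := fun _ => Subtype.ext (PartialHopf.ParAlgebra.ext_of_mul_act rfl rfl)
     right_inv := fun _ => Subtype.ext (PartialHopf.SymmetricPartialModuleAlgebra.ext rfl rfl) },
    fun _ => ⟨rfl, rfl⟩⟩
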